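/- Let $(R,\mathfrak m,k)$ be a commutative Noetherian local ring. For a finitely generated $R$-module $X$ write $\mu_R(X)$ for its minimal number of generators, $\ell_R$ for length and, if $X\neq 0$ and $d=\dim_R X$, $$e_R(X)=d!\,\lim_{n\to\infty}\frac{\ell_R(X/\mathfrak m^nX)}{n^{d}},\qquad e_R(0)=0 .$$ Call $X$ unmixed if $\dim(R/\mathfrak p)=\dim_R X$ for every $\mathfrak p\in\operatorname{Ass}_R(X)$, and Ulrich if $X$ is Cohen--Macaulay and $e_R(X)\le\mu_R(X)$; the zero module counts as Cohen--Macaulay, hence as Ulrich. Let $t\ge 1$ and let $M,N_1,\dots,N_t$ be nonzero finitely generated $R$-modules such that (i) $M$ is unmixed and $e_R(M)=\mu_R(M)$; (ii) $\dim_R(M)=\dim_R(M\otimes_R N_i)$ for all $i=1,\dots,t$; (iii) $M\otimes_R N_i$ is Cohen--Macaulay for all $i=1,\dots,t$. Then the following hold: (a) $M\otimes_R\bigl(\bigotimes_{i=1}^t R^{\oplus\mu_R(N_i)}\bigr)\cong M\otimes_R\bigl(\bigotimes_{i=1}^t N_i\bigr)$ as $R$-modules. (b) $M\otimes_R N_1\otimes_R\cdots\otimes_R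 N_t$ is Ulrich, and $M\otimes_R\bigl(\bigwedge^r_R N_i\bigr)$ is Ulrich for all $i=1,\dots,t$ and all $r\ge 0$. (c) If $\operatorname{Tor}_1^R(M,N_1\otimes_R\cdots\otimes_R N_t)=0$, then $N_i$ is free for all $i=1,\dots,t$. -/

import Mathlib

open scoped TensorProduct

universe u v

noncomputable section

namespace UlrichTensor

variable (R : Type u) [CommRing R] (M : Type v) [AddCommGroup M] [Module R M]

/-- The minimal number of generators `μ_R(M)` of a finitely generated module. -/
def minGens : ℕ := (⊤ : Submodule R M).spanFinrank

/-- The Krull dimension of `M` as a natural number. It agrees with `Module.supportDim R M` for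
nonzero finitely generated modules over a Noetherian local ring (where the dimension is finite),
and it is `0` for the zero module. -/
def natDim : ℕ := ((Module.supportDim R M).unbotD 0).toNat

variable {R} in
/-- `HasMultiplicity I M e` says that the Hilbert-Samuel multiplicity of `M` with respect to `I`
is `e`, that is, `d! · lim ℓ(M / Iⁿ M) / n ^ d` (with `d = dim M`) exists and equals `e`.
For an `𝔪`-primary ideal `I` and finitely generated `M` the lengths are finite. -/
def HasMultiplicity (I : Ideal R) (e : ℝ) : Prop :=
  Filter.Tendsto
    (fun n : ℕ => ((natDim R M).factorial : ℝ) *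
      (((Module.length R (M ⧸ (I ^ n • ⊤ : Submodule R M))).toNat : ℝ) /
        (n : ℝ) ^ natDim R M))
    Filter.atTop (nhds e)

/-- The set `Assh_R(M)` of associated primes `𝔭` of `M` with `dim (R/𝔭) = dim M`. -/
def assh : Set (Ideal R) :=
  {p | p ∈ associatedPrimes R M ∧ ringKrullDim (R ⧸ p) = Module.supportDim R M}

/-- `M` is unmixed: all its associated primes have the dimension of `M`. -/
def IsUnmixed : Prop := associatedPrimes R M = assh R M

/-- The depth of a module over a local ring: the supremum of the lengths of `M`-regular sequences
in the maximal ideal. For nonzero finitely generated `M`, weakly regular sequences in the maximal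
ideal are regular by Nakayama's lemma; for the zero module the value is `⊤`. -/
def depth [IsLocalRing R] : ℕ∞ :=
  ⨆ (rs : List R) (_ : (∀ r ∈ rs, r ∈ IsLocalRing.maximalIdeal R) ∧
    RingTheory.Sequence.IsWeaklyRegular M rs), (rs.length : ℕ∞)

/-- A (finitely generated) module over a local ring is Cohen-Macaulay if it is zero or its depth
equals its dimension. -/
def IsCohenMacaulay [IsLocalRing R] : Prop :=
  Subsingleton M ∨ ((depth R M : ℕ∞) : WithBot ℕ∞) = Module.supportDim R M

variable {R} in
/-- `M` is `c`-Ulrich with respect to the (`𝔪`-primary) ideal `I`: it is Cohen-Macaulay, `M/IM` is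
free over `R/I`, and `e(I, M) ≤ c · ℓ(M/IM)`. -/
structure IsUlrichWith [IsLocalRing R] (c : ℝ) (I : Ideal R) : Prop where
  cohenMacaulay : IsCohenMacaulay R M
  free : Module.Free (R ⧸ I) (M ⧸ (I • ⊤ : Submodule R M))
  multiplicity_le : ∃ e : ℝ, HasMultiplicity M I e ∧
    e ≤ c * ((Module.length R (M ⧸ (I • ⊤ : Submodule R M))).toNat : ℝ)

/-- `M` is Ulrich: it is `1`-Ulrich with respect to the maximal ideal. -/
def IsUlrich [IsLocalRing R] : Prop :=
  IsUlrichWith M 1 (IsLocalRing.maximalIdeal R)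

end UlrichTensor

end

namespace UlrichTensor

open IsLocalRing RingTheory.Sequence
open scoped Pointwise

/-! Choose a minimal free cover `φ i : F i → N i`, of rank `μ(N i)`. Tensoring with `M` gives a
surjection from `Mⁿ`, `n = μ(N i)`, onto the Cohen-Macaulay module `X = M ⊗ N i`, which has the same
dimension `d` as `M` and needs `n · μ(M)` generators. This surjection is injective
(`injective_of_isUnmixed`). Indeed, if its kernel were nonzero, the kernel would contain a copy of
some `R ⧸ p` with `p ∈ Ass M`, and unmixedness gives `dim (R ⧸ p) = d`. By Artin-Rees this copy
contributes a positive amount to the coefficient of `k ^ d`, so `e(X) < n · e(M) = n · μ(M) = μ(X)`.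
But `e(X) ≥ μ(X)` for Cohen-Macaulay `X` (`exists_samuel_one_mul_choose_le`).

Both growth estimates are inequalities between lengths, proved by induction with Pascal's rule; no
Hilbert polynomial is needed. The bound `e ≥ μ` cuts by superficial elements, after passing to
`R(T)` to make the residue field infinite.

Since `F i` is free, injectivity of `M ⊗ φ i` means exactly that `ker (φ i) ≤ Ann(M) F i`. This
condition passes to tensor products and exterior powers of the `φ i` (`ker_piTensorProduct_map_le`,
`ker_exteriorPower_map_le`) and implies injectivity after `M ⊗ -`. Hence every module in (a) and (b)
is a direct sum of copies of `M`, and `M` is itself Cohen-Macaulay.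

For (c), let `K` be the kernel of `⨂ F i → ⨂ N i`. Vanishing of `Tor₁` embeds `M ⊗ K` in `M ⊗ ⨂ F
i`, where its image is zero. So `M ⊗ K = 0`, then `K = 0` by Nakayama, and each `φ i` is injective.
-/

lemma mapQ_surjective {R X Y : Type*} [CommRing R] [AddCommGroup X] [Module R X] [AddCommGroup Y]
    [Module R Y] {f : X →ₗ[R] Y} (hf : Function.Surjective f) {p : Submodule R X}
    {q : Submodule R Y} {h : p ≤ q.comap f} : Function.Surjective (Submodule.mapQ p q f h) :=
  fun y ↦ by
    obtain ⟨y, rfl⟩ := Submodule.Quotient.mk_surjective _ y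
    obtain ⟨x, rfl⟩ := hf y
    exact ⟨Submodule.Quotient.mk x, rfl⟩

lemma length_add_length_le {R A B C : Type*} [CommRing R] [AddCommGroup A] [Module R A]
    [AddCommGroup B] [Module R B] [AddCommGroup C] [Module R C] (f : A →ₗ[R] B) (g : B →ₗ[R] C)
    (hf : Function.Injective f) (hg : Function.Surjective g) (h : g ∘ₗ f = 0) :
    Module.length R A + Module.length R C ≤ Module.length R B := by
  rw [Module.length_eq_add_of_exact (LinearMap.ker g).subtype g
    (Submodule.subtype_injective _) hg (LinearMap.exact_subtype_ker_map g)]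
  gcongr
  exact Module.length_le_of_injective (f.codRestrict (LinearMap.ker g) fun a ↦ congr($h a))
    fun a b hab ↦ hf congr(($hab).1)

/-! ### Hilbert-Samuel functions and a growth bound for `R ⧸ p` -/

section Samuel

variable (R : Type*) [CommRing R] [IsLocalRing R] (X : Type*) [AddCommGroup X] [Module R X]
  {Y : Type*} [AddCommGroup Y] [Module R Y]

/-- The Hilbert-Samuel function `k ↦ ℓ(X / 𝔪 ^ k X)`, with values in `ℕ∞`. -/
noncomputable def samuel (k : ℕ) : ℕ∞ :=
  Module.length R (X ⧸ (maximalIdeal R ^ k • ⊤ : Submodule R X))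

variable {X} in
lemma pow_smul_top_antitone {k l : ℕ} (h : k ≤ l) :
    (maximalIdeal R ^ l • ⊤ : Submodule R X) ≤ maximalIdeal R ^ k • ⊤ :=
  Submodule.smul_mono_left (Ideal.pow_le_pow_right h)

lemma samuel_mono : Monotone (samuel R X) := fun _ _ h ↦
  Module.length_le_of_surjective (Submodule.factor (pow_smul_top_antitone R h))
    (Submodule.factor_surjective _)

variable {R X}

lemma samuel_le_of_surjective (f : X →ₗ[R] Y) (hf : Function.Surjective f) (k : ℕ) :
    samuel R Y k ≤ samuel R X k :=
  Module.length_le_of_surjective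
    (Submodule.mapQ _ _ f (Submodule.smul_top_le_comap_smul_top _ f))
    (mapQ_surjective hf)

lemma samuel_congr (e : X ≃ₗ[R] Y) (k : ℕ) : samuel R X k = samuel R Y k :=
  le_antisymm (samuel_le_of_surjective e.symm.toLinearMap e.symm.surjective k)
    (samuel_le_of_surjective e.toLinearMap e.surjective k)

/-- Multiplication by `x` embeds `X / (𝔪ᵏX : x)` in `X / 𝔪ᵏX`, and its image dies in `(X/xX) / 𝔪ᵏ`.
The hypothesis places the colon module inside `𝔪ˡX`. This is the induction step of both lower
bounds. -/
lemma samuel_add_samuel_quotSMulTop_le {x : R} {k l : ℕ}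
    (h : ∀ u : X, x • u ∈ (maximalIdeal R ^ k • ⊤ : Submodule R X) →
      u ∈ (maximalIdeal R ^ l • ⊤ : Submodule R X)) :
    samuel R X l + samuel R (QuotSMulTop x X) k ≤ samuel R X k := by
  set J : Submodule R X := (maximalIdeal R ^ k • ⊤ : Submodule R X).comap (LinearMap.lsmul R X x)
  have hJ : J ≤ maximalIdeal R ^ l • ⊤ := fun u hu ↦ h u hu
  refine le_trans (add_le_add_left (Module.length_le_of_surjective (Submodule.factor hJ)
    (Submodule.factor_surjective _)) _) (length_add_length_le
    (Submodule.mapQ J _ (LinearMap.lsmul R X x) le_rfl)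
    (Submodule.mapQ _ _ (x • (⊤ : Submodule R X)).mkQ (Submodule.smul_top_le_comap_smul_top _ _))
    ?_ (mapQ_surjective (Submodule.mkQ_surjective _)) ?_)
  · rw [← LinearMap.ker_eq_bot, Submodule.ker_mapQ]
    exact (Submodule.mkQ_map_self _)
  · ext u
    simp only [LinearMap.coe_comp, Function.comp_apply, Submodule.mkQ_apply, Submodule.mapQ_apply,
      LinearMap.lsmul_apply, LinearMap.zero_apply]
    rw [(Submodule.Quotient.mk_eq_zero (x • (⊤ : Submodule R X))).mpr
      (Submodule.smul_mem_pointwise_smul _ _ _ Submodule.mem_top), Submodule.Quotient.mk_zero]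

lemma one_le_samuel [Module.Finite R X] [Nontrivial X] {k : ℕ} (hk : k ≠ 0) :
    1 ≤ samuel R X k := by
  rw [Order.one_le_iff_pos, samuel, Module.length_pos_iff, Submodule.Quotient.nontrivial_iff]
  intro h
  exact Submodule.top_ne_ideal_smul_of_le_jacobson_annihilator
    ((Ideal.pow_le_self hk).trans (maximalIdeal_le_jacobson _)) h.symm

/-- A form of the Artin-Rees lemma. -/
lemma exists_mem_sup_ker_of_apply_mem_pow [IsNoetherianRing R] [Module.Finite R X]
    (f : Y →ₗ[R] X) : ∃ c : ℕ, ∀ (k : ℕ) (u : Y),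
      f u ∈ (maximalIdeal R ^ (k + c) • ⊤ : Submodule R X) →
      u ∈ (maximalIdeal R ^ k • ⊤ : Submodule R Y) ⊔ LinearMap.ker f := by
  obtain ⟨c, hc⟩ := (maximalIdeal R).exists_pow_inf_eq_pow_smul (LinearMap.range f)
  refine ⟨c, fun k u hu ↦ ?_⟩
  have h1 : f u ∈ maximalIdeal R ^ (k + c) • ⊤ ⊓ LinearMap.range f := ⟨hu, u, rfl⟩
  rw [hc _ (Nat.le_add_left c k), Nat.add_sub_cancel] at h1
  have h2 := Submodule.smul_mono le_rfl (inf_le_right :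
    maximalIdeal R ^ c • ⊤ ⊓ LinearMap.range f ≤ LinearMap.range f) h1
  rw [LinearMap.range_eq_map, ← Submodule.map_smul''] at h2
  obtain ⟨v, hv, hvu⟩ := h2
  exact Submodule.mem_sup.mpr ⟨v, hv, u - v, by simp [hvu], by simp⟩

lemma exists_mem_of_smul_mem_pow [IsNoetherianRing R] [Module.Finite R X] {x : R}
    (hx : IsSMulRegular X x) : ∃ c : ℕ, ∀ (k : ℕ) (u : X),
      x • u ∈ (maximalIdeal R ^ (k + c) • ⊤ : Submodule R X) →
      u ∈ (maximalIdeal R ^ k • ⊤ : Submodule R X) := by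
  obtain ⟨c, hc⟩ := exists_mem_sup_ker_of_apply_mem_pow (LinearMap.lsmul R X x)
  refine ⟨c, fun k u hu ↦ ?_⟩
  have h := hc k u hu
  rwa [LinearMap.ker_eq_bot.mpr (show Function.Injective (LinearMap.lsmul R X x) from hx),
    sup_bot_eq] at h

/-- For `p < q` the first two primes of the chain and `x ∈ q \ p`, the element `x` is regular on `R
⧸ p`, and `R ⧸ q` is a quotient of `(R ⧸ p)/x`. So increments of the function of `R ⧸ p` dominate
the function of `R ⧸ q`, and Pascal's rule sums them. Only the order of growth matters here, so the
linear rescaling `c * k + c` may absorb the Artin-Rees shifts. -/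
theorem exists_choose_le_samuel_quotient_prime [IsNoetherianRing R] (d : ℕ) :
    ∀ s : LTSeries (PrimeSpectrum R), s.length = d →
      ∃ c : ℕ, ∀ k, (k.choose d : ℕ∞) ≤ samuel R (R ⧸ s.head.asIdeal) (c * k + c) := by
  induction d with
  | zero =>
    intro s _
    exact ⟨1, fun k ↦ by simpa using one_le_samuel (X := R ⧸ s.head.asIdeal) (by lia)⟩
  | succ d ih =>
    intro s hs
    have hne : s.length ≠ 0 := by lia
    obtain ⟨c₁, h₁⟩ := ih (s.tail hne) (by simp [hs])
    set p := s.head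
    set q := (s.tail hne).head
    have hpq : p < q := by
      have h := s.step ⟨0, by lia⟩
      have h1 : (1 : Fin (s.length + 1)) = (⟨0, by lia⟩ : Fin s.length).succ :=
        Fin.ext (Nat.mod_eq_of_lt (show 1 < s.length + 1 by lia))
      rw [show q = s.toFun 1 from s.head_tail hne, h1]
      exact h
    obtain ⟨x, hxq, hxp⟩ := Set.exists_of_ssubset
      (show (p.asIdeal : Set R) ⊂ q.asIdeal from hpq)
    have hreg : IsSMulRegular (R ⧸ p.asIdeal) x := by
      rw [isSMulRegular_quotient_iff_mem_of_smul_mem]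
      intro y hy
      exact (p.isPrime.mem_or_mem hy).resolve_left hxp
    obtain ⟨c₀, h₀⟩ := exists_mem_of_smul_mem_pow (X := R ⧸ p.asIdeal) hreg
    have hsurj : ∀ k, samuel R (R ⧸ q.asIdeal) k ≤
        samuel R (QuotSMulTop x (R ⧸ p.asIdeal)) k := by
      refine samuel_le_of_surjective (Submodule.liftQ _ (Submodule.factor hpq.le) ?_) ?_
      · rintro _ ⟨u, -, rfl⟩
        obtain ⟨r, rfl⟩ := Submodule.Quotient.mk_surjective _ u
        change Submodule.factor _ (x • (Submodule.Quotient.mk r : R ⧸ p.asIdeal)) = 0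
        rw [← Submodule.Quotient.mk_smul]
        refine (Submodule.Quotient.mk_eq_zero _).mpr ?_
        exact q.asIdeal.mul_mem_right r hxq
      · intro u
        obtain ⟨v, rfl⟩ := Submodule.factor_surjective hpq.le u
        exact ⟨Submodule.Quotient.mk v, rfl⟩
    -- Raising `k` by one must move the argument by at least the Artin-Rees shift `c₀`, and the
    -- argument must stay above `c₁ * k + c₁`.
    refine ⟨max c₀ c₁, fun k ↦ ?_⟩
    set c := max c₀ c₁
    induction k with
    | zero => simp
    | succ k ihk =>
      rw [Nat.choose_succ_succ, add_comm, Nat.cast_add]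
      refine le_trans (add_le_add ihk ((h₁ k).trans ((hsurj _).trans
        (samuel_mono R _ ?_)))) (samuel_add_samuel_quotSMulTop_le (x := x)
        (k := c * (k + 1) + c) fun u hu ↦ h₀ _ u (pow_smul_top_antitone R ?_ hu))
      · have : c₁ ≤ c := le_max_right _ _
        nlinarith [Nat.mul_le_mul_right k this]
      · have : c₀ ≤ c := le_max_left _ _
        rw [mul_add, mul_one]
        lia

end Samuel

/-! ### Depth after cutting by a regular element -/

section DepthDrop

variable {R : Type u} [CommRing R] [IsLocalRing R] [IsNoetherianRing R]
  {X : Type u} [AddCommGroup X] [Module R X] [Module.Finite R X] [Nontrivial X]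

open CategoryTheory Abelian Limits in
-- The element `x` need not begin the given sequence. Depth is therefore read off from the vanishing
-- of `Ext(R/𝔪, -)`, and the long exact sequence of multiplication by `x` loses one degree.
lemma exists_isRegular_quotSMulTop {x : R} (hx : IsSMulRegular X x) (hxm : x ∈ maximalIdeal R)
    {rs : List R} (hm : ∀ r ∈ rs, r ∈ maximalIdeal R) (hrs : IsWeaklyRegular X rs) {d : ℕ}
    (hd : rs.length = d + 1) : ∃ rs' : List R, rs'.length = d ∧ (∀ r ∈ rs', r ∈ maximalIdeal R) ∧
      IsWeaklyRegular (QuotSMulTop x X) rs' := by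
  have hlt (Z : Type u) [AddCommGroup Z] [Module R Z] [Module.Finite R Z] [Nontrivial Z] :
      maximalIdeal R • (⊤ : Submodule R (ModuleCat.of R Z)) < ⊤ :=
    lt_top_iff_ne_top.mpr (Submodule.top_ne_ideal_smul_of_le_jacobson_annihilator
      (maximalIdeal_le_jacobson _)).symm
  have : Nontrivial (QuotSMulTop x X) := nontrivial_quotSMulTop_of_mem_maximalIdeal X hxm
  have hreg := (isRegular_iff_isWeaklyRegular_of_subset_maximalIdeal hm).mpr hrs
  let κ := ModuleCat.of R (R ⧸ maximalIdeal R)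
  have hsupp : Module.support R κ = PrimeSpectrum.zeroLocus (maximalIdeal R) := by
    change Module.support R (R ⧸ maximalIdeal R) = _
    rw [Module.support_eq_zeroLocus, Ideal.annihilator_quotient]
  have hvan := ModuleCat.subsingleton_ext_of_exists_isRegular (maximalIdeal R) κ hsupp.subset
    (ModuleCat.of R X) (hlt X) rs hm hreg
  have hvan' : ∀ i < d, Subsingleton (Ext κ (ModuleCat.of R (QuotSMulTop x X)) i) := by
    intro i hi
    have zero1 := AddCommGrpCat.isZero_of_iff_subsingleton.mpr (hvan i (by lia))
    have zero2 := AddCommGrpCat.isZero_of_iff_subsingleton.mpr (hvan (i + 1) (by lia))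
    have hx' : IsSMulRegular (ModuleCat.of R X) x := hx
    exact AddCommGrpCat.subsingleton_of_isZero <| ShortComplex.Exact.isZero_of_both_zeros
      ((Ext.covariant_sequence_exact₃' κ hx'.smulShortComplex_shortExact) i (i + 1) rfl)
      (zero1.eq_zero_of_src _) (zero2.eq_zero_of_tgt _)
  obtain ⟨rs', h1, h2, h3⟩ := ModuleCat.exists_isRegular_of_exists_subsingleton_ext
    (maximalIdeal R) d (ModuleCat.of R (QuotSMulTop x X)) (hlt _) κ hsupp hvan'
  exact ⟨rs', h1, h2, h3.toIsWeaklyRegular⟩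

end DepthDrop

open IsLocalRing RingTheory.Sequence
open scoped Pointwise

/-! ### Generic elements over an infinite residue field -/

section Superficial

variable {R : Type*} [CommRing R] [IsLocalRing R] {X : Type*} [AddCommGroup X] [Module R X]

/-- By Nakayama the submodules stay proper in `X / 𝔪X`, and a vector space over an infinite field is
not a finite union of proper subspaces. -/
lemma exists_forall_notMem_of_infinite_residueField [Infinite (ResidueField R)]
    [Module.Finite R X] {s : Set (Submodule R X)} (hs : s.Finite) (h : ∀ V ∈ s, V ≠ ⊤) :
    ∃ x : X, ∀ V ∈ s, x ∉ V := by
  classical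
  let : Field (R ⧸ maximalIdeal R) := Ideal.Quotient.field _
  have : Infinite (R ⧸ maximalIdeal R) := ‹Infinite (ResidueField R)›
  let Q := X ⧸ (maximalIdeal R • ⊤ : Submodule R X)
  let φ : Submodule R X → Submodule (R ⧸ maximalIdeal R) Q := fun V ↦
    { V.map (maximalIdeal R • ⊤ : Submodule R X).mkQ with
      smul_mem' := by
        intro c x hx
        obtain ⟨r, rfl⟩ := Ideal.Quotient.mk_surjective c
        exact (V.map (maximalIdeal R • ⊤ : Submodule R X).mkQ).smul_mem r hx }
  have hφ : (⊤ : Submodule (R ⧸ maximalIdeal R) Q) ∉ hs.toFinset.image φ := by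
    intro hmem
    obtain ⟨V, hV, hVt⟩ := Finset.mem_image.mp hmem
    refine h V (hs.mem_toFinset.mp hV) (top_le_iff.mp ?_)
    refine Submodule.le_of_le_smul_of_le_jacobson_bot Module.Finite.fg_top
      (maximalIdeal_le_jacobson _) fun x _ ↦ ?_
    have hx : (Submodule.Quotient.mk x : Q) ∈ φ V := hVt ▸ Submodule.mem_top
    obtain ⟨v, hv, hvx⟩ := hx
    rw [Submodule.mkQ_apply, Submodule.Quotient.eq] at hvx
    exact Submodule.mem_sup.mpr ⟨v, hv, x - v, by simpa using Submodule.neg_mem _ hvx, by simp⟩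
  have hne := Subspace.biUnion_ne_univ_of_top_notMem hφ
  obtain ⟨q, hq⟩ := (Set.ne_univ_iff_exists_notMem _).mp hne
  obtain ⟨x, rfl⟩ := Submodule.Quotient.mk_surjective _ q
  refine ⟨x, fun V hV hxV ↦ hq ?_⟩
  refine Set.mem_iUnion₂.mpr ⟨φ V, Finset.mem_image_of_mem _ (hs.mem_toFinset.mpr hV), ?_⟩
  exact ⟨x, hxV, rfl⟩

end Superficial

/-! ### The associated graded module over the Rees algebra -/

section Subquotient

variable {S A : Type*} [CommRing S] [AddCommGroup A] [Module S A] (P Q : Submodule S A)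

/-- The quotient of `P` by its intersection with `Q`. -/
def subquotient : Type _ := P ⧸ Q.comap P.subtype

noncomputable instance : AddCommGroup (subquotient P Q) :=
  inferInstanceAs (AddCommGroup (P ⧸ Q.comap P.subtype))

noncomputable instance : Module S (subquotient P Q) :=
  inferInstanceAs (Module S (P ⧸ Q.comap P.subtype))

/-- The quotient map to `subquotient P Q`. -/
def subquotient.mk : P →ₗ[S] subquotient P Q := (Q.comap P.subtype).mkQ

variable {P Q}

lemma subquotient.mk_eq_zero_iff (x : P) : subquotient.mk P Q x = 0 ↔ (x : A) ∈ Q :=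
  Submodule.Quotient.mk_eq_zero _

lemma subquotient.smul_mk (s : S) {x : A} (hx : x ∈ P) :
    s • subquotient.mk P Q ⟨x, hx⟩ = subquotient.mk P Q ⟨s • x, P.smul_mem s hx⟩ := rfl

lemma subquotient.finite (hP : P.FG) : Module.Finite S (subquotient P Q) :=
  have : Module.Finite S P := Module.Finite.iff_fg.mpr hP
  inferInstanceAs (Module.Finite S (P ⧸ Q.comap P.subtype))

end Subquotient

section Rees

variable {R : Type*} [CommRing R] (I : Ideal R) (X : Type*) [AddCommGroup X] [Module R X]

variable {I} in
lemma mem_pow_one {a : R} (h : a ∈ I) : a ∈ I ^ 1 := (pow_one I).symm ▸ h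

/-- The homogeneous element `a tⁿ` of the Rees algebra. -/
noncomputable def reesMonomial {n : ℕ} {a : R} (h : a ∈ I ^ n) : reesAlgebra I :=
  ⟨Polynomial.monomial n a, reesAlgebra.monomial_mem.mpr h⟩

/-- The ideal of the Rees algebra generated by the elements of degree one. -/
noncomputable def reesIrrelevant : Ideal (reesAlgebra I) :=
  Ideal.span {s | ∃ (a : R) (h : a ∈ I ^ 1), s = reesMonomial I h}

variable {I} in
lemma reesMonomial_mem {n : ℕ} : ∀ {a : R} (h : a ∈ I ^ n),
    reesMonomial I h ∈ reesIrrelevant I ^ n := by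
  induction n with
  | zero => simp
  | succ n ih =>
    intro a h
    rw [pow_succ] at h
    induction h using Submodule.mul_induction_on' with
    | mem_mul_mem b hb c hc =>
      have hc' : c ∈ I ^ 1 := by rwa [pow_one]
      have : reesMonomial I (n := n + 1) (a := b * c) (by rwa [pow_succ]) =
          reesMonomial I hb * reesMonomial I hc' :=
        Subtype.ext (by simp [reesMonomial, Polynomial.monomial_mul_monomial])
      rw [this, pow_succ]
      exact Ideal.mul_mem_mul (ih hb) (Ideal.subset_span ⟨c, hc', rfl⟩)
    | add b hb c hc h1 h2 =>
      have h3 := Ideal.add_mem _ (h1 (by rwa [pow_succ])) (h2 (by rwa [pow_succ]))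
      convert h3 using 1
      exact Subtype.ext (by simp [reesMonomial])

/-- The filtration `k ↦ I ^ (k + 1) X`. -/
noncomputable def shiftedFiltration : I.Filtration X where
  N i := I ^ (i + 1) • ⊤
  mono i := Submodule.smul_mono_left (Ideal.pow_le_pow_right (by lia))
  smul_le i := by rw [← Submodule.mul_smul, ← pow_succ']

/-- The module associated with the `I`-adic filtration, as a submodule of `X[t]`. -/
noncomputable abbrev reesModule : Submodule (reesAlgebra I) (PolynomialModule R X) :=
  (I.stableFiltration (⊤ : Submodule R X)).submodule

/-- The associated graded module of the `I`-adic filtration, over the Rees algebra. -/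
abbrev gradedModule : Type _ :=
  subquotient (reesModule I X) (shiftedFiltration I X).submodule

variable {I X} in
lemma single_mem_reesModule {k : ℕ} {u : X} (h : u ∈ (I ^ k • ⊤ : Submodule R X)) :
    PolynomialModule.single R k u ∈ reesModule I X := by
  intro i
  rw [PolynomialModule.coeff_single, Finsupp.single_apply]
  split_ifs with hi
  · exact hi ▸ h
  · exact zero_mem _

variable {X} in
/-- The class of `u ∈ I ^ k X` in degree `k` of the associated graded module. -/
noncomputable def initialForm {k : ℕ} {u : X} (h : u ∈ (I ^ k • ⊤ : Submodule R X)) :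
    gradedModule I X :=
  subquotient.mk (reesModule I X) (shiftedFiltration I X).submodule
    ⟨PolynomialModule.single R k u, single_mem_reesModule h⟩

variable {I X}

lemma initialForm_eq_zero_iff {k : ℕ} {u : X} (h : u ∈ (I ^ k • ⊤ : Submodule R X)) :
    initialForm I h = 0 ↔ u ∈ (I ^ (k + 1) • ⊤ : Submodule R X) := by
  rw [initialForm, subquotient.mk_eq_zero_iff]
  change (∀ i, (PolynomialModule.single R k u).coeff i ∈ _) ↔ _
  constructor
  · intro hu
    have := hu k
    simpa [PolynomialModule.coeff_single] using! this
  · intro hu i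
    rw [PolynomialModule.coeff_single, Finsupp.single_apply]
    split_ifs with hi
    · exact hi ▸ hu
    · exact zero_mem _

lemma reesMonomial_smul_initialForm {n k : ℕ} {a : R} {u : X} (ha : a ∈ I ^ n)
    (h : u ∈ (I ^ k • ⊤ : Submodule R X)) :
    reesMonomial I ha • initialForm I h = initialForm I (k := n + k) (u := a • u)
      (by rw [pow_add, Submodule.mul_smul]; exact Submodule.smul_mem_smul ha h) := by
  refine (subquotient.smul_mk (reesMonomial I ha) (single_mem_reesModule h)).trans ?_
  refine congrArg (subquotient.mk _ _) (Subtype.ext ?_)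
  exact PolynomialModule.monomial_smul_single n a k u

lemma finite_gradedModule [IsNoetherianRing R] [Module.Finite R X] :
    Module.Finite (reesAlgebra I) (gradedModule I X) := by
  exact subquotient.finite
    ((Ideal.Filtration.submodule_fg_iff_stable _ fun i ↦ IsNoetherian.noetherian _).mpr
      (I.stableFiltration_stable ⊤))

/-- The filtration of elements whose product with `x ∈ I` has unexpectedly high order. -/
noncomputable def colonFiltration (x : R) : I.Filtration X where
  N k := I ^ k • ⊤ ⊓ (I ^ (k + 2) • ⊤ : Submodule R X).comap (LinearMap.lsmul R X x)
  mono k := inf_le_inf (Submodule.smul_mono_left (Ideal.pow_le_pow_right (by lia)))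
    (Submodule.comap_mono (Submodule.smul_mono_left (Ideal.pow_le_pow_right (by lia))))
  smul_le k := by
    rw [Submodule.smul_le]
    rintro r hr n ⟨h1, h2⟩
    refine ⟨?_, ?_⟩
    · rw [pow_succ', Submodule.mul_smul]
      exact Submodule.smul_mem_smul hr h1
    · change x • r • n ∈ (I ^ (k + 1 + 2) • ⊤ : Submodule R X)
      rw [smul_comm, show k + 1 + 2 = (k + 2) + 1 by rfl, pow_succ', Submodule.mul_smul]
      exact Submodule.smul_mem_smul hr h2

/-- Let `W` be the kernel of `xt` on the graded module. Every prime minimal over `Ann W` is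
associated and contains `xt`, hence contains the irrelevant ideal; so a power of that ideal kills
`W`. The colon filtration is stable, so its terms in high degree are obtained from one term by
powers of `I`, and the power that kills `W` pushes them one degree deeper. -/
lemma exists_colonFiltration_le [IsNoetherianRing R] [Module.Finite R X] {x : R} (hx : x ∈ I ^ 1)
    (h : ∀ p ∈ associatedPrimes (reesAlgebra I) (gradedModule I X),
      reesMonomial I hx ∈ p → reesIrrelevant I ≤ p) :
    ∃ K, ∀ k ≥ K, ∀ u ∈ (I ^ k • ⊤ : Submodule R X),
      x • u ∈ (I ^ (k + 2) • ⊤ : Submodule R X) → u ∈ (I ^ (k + 1) • ⊤ : Submodule R X) := by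
  have := finite_gradedModule (I := I) (X := X)
  set W : Submodule (reesAlgebra I) (gradedModule I X) :=
    LinearMap.ker (LinearMap.lsmul (reesAlgebra I) (gradedModule I X) (reesMonomial I hx))
  have hrad : reesIrrelevant I ≤ (Module.annihilator (reesAlgebra I) W).radical := by
    rw [← Ideal.sInf_minimalPrimes]
    refine le_sInf fun p hp ↦ ?_
    have hpW := Module.associatedPrimes.minimalPrimes_annihilator_subset_associatedPrimes _ _ hp
    refine h p (associatedPrimes.subset_of_injective (Submodule.subtype_injective W) hpW) ?_
    refine hp.1.2 (Module.mem_annihilator.mpr fun w ↦ Subtype.ext ?_)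
    exact w.2
  obtain ⟨c, hc⟩ := Ideal.exists_pow_le_of_le_radical_of_fg hrad (IsNoetherian.noetherian _)
  have hle : colonFiltration x ≤ I.stableFiltration (⊤ : Submodule R X) := fun i ↦ inf_le_left
  obtain ⟨n₀, hn₀⟩ := ((I.stableFiltration_stable (⊤ : Submodule R X)).of_le hle).exists_pow_smul_eq
  have hkill : I ^ c • (colonFiltration x : I.Filtration X).N n₀ ≤ I ^ (c + n₀ + 1) • ⊤ := by
    rw [Submodule.smul_le]
    rintro a ha u ⟨h1, h2⟩
    have hw : initialForm I h1 ∈ W := by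
      change reesMonomial I hx • initialForm I h1 = 0
      rw [reesMonomial_smul_initialForm, initialForm_eq_zero_iff]
      rwa [show 1 + n₀ + 1 = n₀ + 2 by lia]
    have h0 := Module.mem_annihilator.mp (hc (reesMonomial_mem ha)) ⟨_, hw⟩
    have h0' : reesMonomial I ha • initialForm I h1 = 0 := congr(($h0).1)
    rwa [reesMonomial_smul_initialForm, initialForm_eq_zero_iff] at h0'
  refine ⟨n₀ + c, fun k hk u hu hxu ↦ ?_⟩
  have hmem : u ∈ (colonFiltration x : I.Filtration X).N (n₀ + (k - n₀)) := by
    rw [Nat.add_sub_cancel' (by lia)]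
    exact ⟨hu, hxu⟩
  rw [hn₀, show k - n₀ = (k - n₀ - c) + c by lia, pow_add, Submodule.mul_smul] at hmem
  have h3 := Submodule.smul_mono le_rfl hkill hmem
  rw [← Submodule.mul_smul, ← pow_add] at h3
  convert h3 using 3
  lia

end Rees

/-! ### Superficial elements and the bound `e ≥ μ` -/

section Superficial

variable {R : Type*} [CommRing R] [IsLocalRing R] [IsNoetherianRing R] [Infinite (ResidueField R)]
  {X : Type*} [AddCommGroup X] [Module R X] [Module.Finite R X]

/-- Over an infinite residue field, a module of positive depth has a superficial regular
element. -/
theorem exists_superficial {r : R} (hr : r ∈ maximalIdeal R) (hreg : IsSMulRegular X r) :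
    ∃ x ∈ maximalIdeal R, IsSMulRegular X x ∧ ∃ K, ∀ k ≥ K, ∀ u : X,
      x • u ∈ (maximalIdeal R ^ (k + 1) • ⊤ : Submodule R X) →
      u ∈ (maximalIdeal R ^ k • ⊤ : Submodule R X) := by
  set I := maximalIdeal R
  have := finite_gradedModule (I := I) (X := X)
  let φ : Ideal (reesAlgebra I) → Submodule R I := fun p ↦
    { carrier := {a | reesMonomial I (n := 1) (mem_pow_one a.2) ∈ p}
      add_mem' := by
        intro a b ha hb
        have h := p.add_mem ha hb
        simp only [Set.mem_ofPred_eq]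
        convert h using 1
        exact Subtype.ext (by simp [reesMonomial])
      zero_mem' := by
        simp only [Set.mem_ofPred_eq]
        convert p.zero_mem using 1
        exact Subtype.ext (by simp [reesMonomial])
      smul_mem' := by
        intro c a ha
        have h := p.mul_mem_left (algebraMap R _ c) ha
        simp only [Set.mem_ofPred_eq]
        convert h using 1
        exact Subtype.ext (by simp [reesMonomial, Polynomial.C_mul_monomial]) }
  -- Avoiding the first family gives superficiality in high degrees; avoiding the second gives
  -- regularity. Members of the second are proper because the regular element `r` lies in no
  -- associated prime of `X`.
  let s : Set (Submodule R I) :=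
    φ '' {p ∈ associatedPrimes (reesAlgebra I) (gradedModule I X) | ¬ reesIrrelevant I ≤ p} ∪
    (fun q : Ideal R ↦ Submodule.comap I.subtype q) '' associatedPrimes R X
  have hs : s.Finite :=
    (((associatedPrimes.finite _ _).subset (Set.sep_subset _ _)).image _).union
      ((associatedPrimes.finite R X).image _)
  obtain ⟨x, hx⟩ := exists_forall_notMem_of_infinite_residueField hs (by
    rintro V (⟨p, ⟨-, hp⟩, rfl⟩ | ⟨q, hq, rfl⟩) htop
    · refine hp (Ideal.span_le.mpr ?_)
      rintro _ ⟨a, ha, rfl⟩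
      have : (⟨a, by rwa [pow_one] at ha⟩ : I) ∈ φ p := htop ▸ Submodule.mem_top
      exact this
    · change Submodule.comap I.subtype q = ⊤ at htop
      have h1 : (⟨r, hr⟩ : I) ∈ Submodule.comap I.subtype q := htop ▸ Submodule.mem_top
      have h2 : r ∈ ⋃ p ∈ associatedPrimes R X, (p : Set R) := Set.mem_biUnion hq h1
      rw [biUnion_associatedPrimes_eq_compl_regular] at h2
      exact h2 hreg)
  have hxreg : IsSMulRegular X (x : R) := by
    by_contra hcon
    have h2 : (x : R) ∈ ⋃ p ∈ associatedPrimes R X, (p : Set R) := by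
      rw [biUnion_associatedPrimes_eq_compl_regular]
      exact hcon
    obtain ⟨q, hq, hxq⟩ := Set.mem_iUnion₂.mp h2
    exact hx _ (Or.inr ⟨q, hq, rfl⟩) hxq
  obtain ⟨K, hK⟩ := exists_colonFiltration_le (X := X) (I := I) (x := x) (mem_pow_one x.2)
    fun p hp hxp ↦ by_contra fun hcon ↦ hx _ (Or.inl ⟨p, ⟨hp, hcon⟩, rfl⟩) hxp
  obtain ⟨c, hc⟩ := exists_mem_of_smul_mem_pow hxreg
  refine ⟨x, x.2, hxreg, K + c, fun k hk u hu ↦ ?_⟩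
  -- Artin-Rees puts `u` in `𝔪 ^ K X`; from there superficiality raises the order one degree at a
  -- time.
  have key : ∀ j, K + j ≤ k → u ∈ (I ^ (K + j) • ⊤ : Submodule R X) := by
    intro j
    induction j with
    | zero => exact fun _ ↦ hc _ _ (pow_smul_top_antitone R (by lia) hu)
    | succ j ih =>
      exact fun hj ↦ hK _ (by lia) u (ih (by lia)) (pow_smul_top_antitone R (by lia) hu)
  have h := key (k - K) (by lia)
  rwa [show K + (k - K) = k by lia] at h

end Superficial

section LowerBound

variable {R : Type u} [CommRing R] [IsLocalRing R]

lemma samuel_one_quotSMulTop {X : Type*} [AddCommGroup X] [Module R X] {x : R}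
    (hx : x ∈ maximalIdeal R) : samuel R X 1 ≤ samuel R (QuotSMulTop x X) 1 := by
  have hle : x • (⊤ : Submodule R X) ≤ maximalIdeal R ^ 1 • ⊤ := by
    rw [pow_one, ← Submodule.ideal_span_singleton_smul]
    exact Submodule.smul_mono_left ((Ideal.span_singleton_le_iff_mem _).mpr hx)
  refine Module.length_le_of_surjective (Submodule.liftQ _ (Submodule.factor hle) ?_) ?_
  · rw [Submodule.smul_le]
    rintro a ha n -
    obtain ⟨n, rfl⟩ := Submodule.Quotient.mk_surjective _ n
    exact (Submodule.Quotient.mk_eq_zero _).mpr (Submodule.smul_mem_smul ha Submodule.mem_top)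
  · intro u
    obtain ⟨v, rfl⟩ := Submodule.factor_surjective hle u
    exact ⟨Submodule.Quotient.mk v, rfl⟩

/-- For superficial `x`, increments of the function of `X` dominate the function of `X/xX` with a
loss of exactly one degree per step, and `x ∈ 𝔪` does not lower the number of generators. The
argument is only translated, not rescaled, so the leading coefficient `μ(X)/d!` survives. -/
theorem exists_samuel_one_mul_choose_le_of_infinite [IsNoetherianRing R]
    [Infinite (ResidueField R)] (d : ℕ) :
    ∀ (X : Type u) [AddCommGroup X] [Module R X] [Module.Finite R X] (rs : List R),
      rs.length = d → (∀ r ∈ rs, r ∈ maximalIdeal R) → IsWeaklyRegular X rs →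
      ∃ c, ∀ k, samuel R X 1 * (k.choose d : ℕ∞) ≤ samuel R X (k + c) := by
  induction d with
  | zero => exact fun X _ _ _ _ _ _ _ ↦ ⟨1, fun k ↦ by simpa using samuel_mono R X (by lia)⟩
  | succ d ih =>
    intro X _ _ _ rs hlen hm hreg
    rcases subsingleton_or_nontrivial X with hX | hX
    · exact ⟨0, fun k ↦ by simp [samuel, Module.length_eq_zero]⟩
    obtain ⟨r, rs, rfl⟩ := List.exists_cons_of_length_eq_add_one hlen
    obtain ⟨x, hxm, hx, K, hK⟩ := exists_superficial (hm r (by simp))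
      ((isWeaklyRegular_cons_iff X r rs).mp hreg).1
    obtain ⟨rs', hlen', hm', hreg'⟩ := exists_isRegular_quotSMulTop hx hxm hm hreg hlen
    obtain ⟨c, hc⟩ := ih (QuotSMulTop x X) rs' hlen' hm' hreg'
    refine ⟨max c K, fun k ↦ ?_⟩
    induction k with
    | zero => simp
    | succ k ihk =>
      rw [Nat.choose_succ_succ, add_comm (k.choose d), Nat.cast_add, mul_add]
      refine le_trans (add_le_add ihk (le_trans (mul_le_mul_left (samuel_one_quotSMulTop hxm) _)
        ((hc k).trans (samuel_mono R _ ?_)))) (samuel_add_samuel_quotSMulTop_le (x := x)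
        (k := k + 1 + max c K) fun u hu ↦ hK _ (by lia) u (pow_smul_top_antitone R (by lia) hu))
      lia

end LowerBound

open IsLocalRing RingTheory.Sequence
open scoped Pointwise

/-! ### Reduction to an infinite residue field by passing to `R(T)` -/

section BaseChange

/-- Flat base change multiplies length by the length of `S/𝔪S`, which is `1` here. -/
lemma samuel_baseChange {R S : Type*} [CommRing R] [IsLocalRing R] [CommRing S] [IsLocalRing S]
    [Algebra R S] [Module.Flat R S] (hS : (maximalIdeal R).map (algebraMap R S) = maximalIdeal S)
    (X : Type*) [AddCommGroup X] [Module R X] (k : ℕ) :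
    samuel S (S ⊗[R] X) k = samuel R X k := by
  have : IsLocalHom (algebraMap R S) :=
    ((local_hom_TFAE (algebraMap R S)).out 0 2).mpr hS.le
  have h1 : Module.length S (S ⧸ (maximalIdeal R).map (algebraMap R S)) = 1 := by
    rw [hS, Module.length_eq_one_iff, isSimpleModule_iff_quot_maximal]
    exact ⟨_, maximalIdeal.isMaximal S, ⟨LinearEquiv.refl _ _⟩⟩
  have h2 := IsLocalRing.length_baseChange R S (X ⧸ (maximalIdeal R ^ k • ⊤ : Submodule R X))
  rw [h1, mul_one] at h2
  rw [samuel, samuel, ← h2, ← hS, ← Ideal.map_pow]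
  exact (TensorProduct.tensorQuotMapSMulEquivTensorQuot X S (maximalIdeal R ^ k)).length_eq

variable (R : Type u) [CommRing R] [IsLocalRing R]

/-- The extension of the maximal ideal of `R` to `R[T]`. -/
noncomputable abbrev extendedMaximal : Ideal (Polynomial R) := (maximalIdeal R).map Polynomial.C

/-- The localization `R(T)` of `R[T]` at the extension of the maximal ideal of `R`. -/
abbrev genericExtension : Type u := Localization.AtPrime (extendedMaximal R)

instance : Module.Flat R (genericExtension R) :=
  have : Module.Flat (Polynomial R) (genericExtension R) :=
    IsLocalization.flat _ (extendedMaximal R).primeCompl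
  Module.Flat.trans R (Polynomial R) _

lemma map_maximalIdeal_genericExtension :
    (maximalIdeal R).map (algebraMap R (genericExtension R)) =
      maximalIdeal (genericExtension R) := by
  rw [← Localization.AtPrime.map_eq_maximalIdeal, Ideal.map_map,
    IsScalarTower.algebraMap_eq R (Polynomial R) (genericExtension R)]
  rfl

instance : Infinite (ResidueField (genericExtension R)) := by
  refine Infinite.of_injective (fun n : ℕ ↦ residue (genericExtension R)
    (algebraMap (Polynomial R) _ (Polynomial.X ^ n))) fun n m h ↦ ?_
  by_contra hne
  replace h : residue (genericExtension R)
      (algebraMap (Polynomial R) _ (Polynomial.X ^ n - Polynomial.X ^ m)) = 0 := by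
    rw [map_sub, map_sub, sub_eq_zero]
    exact h
  rw [residue_eq_zero_iff, IsLocalization.AtPrime.to_map_mem_maximal_iff _ (extendedMaximal R),
    Ideal.mem_map_C_iff] at h
  have h1 := h n
  rw [Polynomial.coeff_sub, Polynomial.coeff_X_pow_self, Polynomial.coeff_X_pow, if_neg hne,
    sub_zero] at h1
  exact (Ideal.ne_top_iff_one _).mp (maximalIdeal.isMaximal R).ne_top h1

variable {R}

lemma exists_samuel_one_mul_choose_le_of_flat {S : Type u} [CommRing S] [IsLocalRing S]
    [IsNoetherianRing S] [Algebra R S] [Module.Flat R S] [Infinite (ResidueField S)]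
    (hS : (maximalIdeal R).map (algebraMap R S) = maximalIdeal S) {X : Type u} [AddCommGroup X]
    [Module R X] [Module.Finite R X] {rs : List R} (hm : ∀ r ∈ rs, r ∈ maximalIdeal R)
    (hrs : IsWeaklyRegular X rs) :
    ∃ c, ∀ k, samuel R X 1 * (k.choose rs.length : ℕ∞) ≤ samuel R X (k + c) := by
  obtain ⟨c, hc⟩ := exists_samuel_one_mul_choose_le_of_infinite (R := S) rs.length (S ⊗[R] X)
    (rs.map (algebraMap R S)) (by simp) (by
      intro r hr
      obtain ⟨s, hs, rfl⟩ := List.mem_map.mp hr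
      exact hS ▸ Ideal.mem_map_of_mem _ (hm s hs))
    (hrs.of_flat_of_isBaseChange (TensorProduct.isBaseChange R X S))
  refine ⟨c, fun k ↦ ?_⟩
  simpa only [samuel_baseChange hS] using hc k

/-- The Hilbert-Samuel function of a module of depth at least `d` is bounded below by
`ℓ(X / 𝔪 X) · C(k - c, d)`. -/
theorem exists_samuel_one_mul_choose_le [IsNoetherianRing R] {X : Type u} [AddCommGroup X]
    [Module R X] [Module.Finite R X] {rs : List R} (hm : ∀ r ∈ rs, r ∈ maximalIdeal R)
    (hrs : IsWeaklyRegular X rs) :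
    ∃ c, ∀ k, samuel R X 1 * (k.choose rs.length : ℕ∞) ≤ samuel R X (k + c) :=
  have : IsNoetherianRing (genericExtension R) :=
    IsLocalization.isNoetherianRing (extendedMaximal R).primeCompl _ inferInstance
  exists_samuel_one_mul_choose_le_of_flat (map_maximalIdeal_genericExtension R) hm hrs

end BaseChange

section FiniteLength

variable {R : Type*} [CommRing R] [IsLocalRing R] [IsNoetherianRing R]

lemma samuel_ne_top (X : Type*) [AddCommGroup X] [Module R X] [Module.Finite R X] (k : ℕ) :
    samuel R X k ≠ ⊤ := by
  rcases eq_or_ne k 0 with rfl | hk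
  · have : Subsingleton (X ⧸ (maximalIdeal R ^ 0 • ⊤ : Submodule R X)) := by
      rw [pow_zero, Ideal.one_eq_top, Submodule.top_smul]
      infer_instance
    simp [samuel, Module.length_eq_zero]
  have hart : IsArtinianRing (R ⧸ maximalIdeal R ^ k) := by
    refine quotient_artinian_of_mem_minimalPrimes_of_isLocalRing _ ⟨⟨inferInstance,
      Ideal.pow_le_self hk⟩, fun q hq _ ↦ ?_⟩
    exact hq.1.le_of_pow_le hq.2
  have h1 : IsArtinian (R ⧸ maximalIdeal R ^ k) (X ⧸ (maximalIdeal R ^ k • ⊤ : Submodule R X)) :=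
    have : Module.Finite (R ⧸ maximalIdeal R ^ k) (X ⧸ (maximalIdeal R ^ k • ⊤ : Submodule R X)) :=
      Module.Finite.of_restrictScalars_finite R _ _
    inferInstance
  have h2 : IsArtinian R (X ⧸ (maximalIdeal R ^ k • ⊤ : Submodule R X)) :=
    isArtinian_of_surjective_algebraMap (R := R ⧸ maximalIdeal R ^ k) Ideal.Quotient.mk_surjective
  exact Module.length_ne_top

end FiniteLength

open IsLocalRing RingTheory.Sequence Filter Topology

/-! ### Comparison of leading coefficients -/

section Asymptotics

lemma tendsto_factorial_mul_choose_div (d a b c : ℕ) (hc : c ≠ 0) :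
    Tendsto (fun k : ℕ ↦ (d.factorial : ℝ) * (((a * k).choose d : ℝ) / ((c * k + b : ℕ) : ℝ) ^ d))
      atTop (𝓝 ((a / c : ℝ) ^ d)) := by
  have hlin : Tendsto (fun k : ℕ ↦ ((a * k : ℕ) : ℝ) / ((c * k + b : ℕ) : ℝ)) atTop
      (𝓝 (a / c : ℝ)) := by
    have h1 : Tendsto (fun k : ℕ ↦ (a : ℝ) / (c + b / (k : ℝ))) atTop (𝓝 (a / (c + 0) : ℝ)) :=
      tendsto_const_nhds.div (tendsto_const_nhds.add (tendsto_const_div_atTop_nhds_zero_nat _))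
        (by simpa using hc)
    rw [add_zero] at h1
    refine h1.congr' ?_
    filter_upwards [eventually_gt_atTop 0] with k hk
    have : (k : ℝ) ≠ 0 := by positivity
    push_cast
    field_simp
  rcases Nat.eq_zero_or_pos a with rfl | ha
  · rcases Nat.eq_zero_or_pos d with rfl | hd
    · simp
    · simp [Nat.choose_eq_zero_of_lt hd, hd.ne']
  have hone : Tendsto (fun m : ℕ ↦ (m.choose d : ℝ) / ((m : ℝ) ^ d / d.factorial)) atTop (𝓝 1) := by
    refine (Asymptotics.isEquivalent_iff_tendsto_one ?_).mp (isEquivalent_choose d)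
    filter_upwards [eventually_gt_atTop 0] with m hm
    positivity
  have hmul : Tendsto (fun k : ℕ ↦ a * k) atTop atTop :=
    tendsto_id.const_mul_atTop' ha
  have h2 := (hone.comp hmul).mul (hlin.pow d)
  rw [one_mul] at h2
  refine h2.congr' ?_
  filter_upwards [eventually_gt_atTop 0] with k hk
  have h3 : ((a * k : ℕ) : ℝ) ≠ 0 := by positivity
  have h4 : ((c * k + b : ℕ) : ℝ) ≠ 0 := by positivity
  simp only [Function.comp_apply, div_pow]
  field_simp

/-- Multiply by `d! / (a * k + b) ^ d` and let `k → ∞`: the inequality becomes `a⁻ᵈ + n * e ≤ n *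
e`. -/
lemma not_forall_choose_add_le {f : ℕ → ℕ} {d a b n e : ℕ} (ha : a ≠ 0)
    (hf : Tendsto (fun m : ℕ ↦ (d.factorial : ℝ) * ((f m : ℝ) / (m : ℝ) ^ d)) atTop (𝓝 (e : ℝ)))
    (h : ∀ k, k.choose d + n * e * (a * k).choose d ≤ n * f (a * k + b)) : False := by
  have hmul : Tendsto (fun k : ℕ ↦ a * k + b) atTop atTop :=
    tendsto_atTop_mono (fun k ↦ Nat.le_add_right _ b)
      (tendsto_id.const_mul_atTop' (Nat.pos_of_ne_zero ha))
  have h1 := (hf.comp hmul).const_mul (n : ℝ)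
  have h2 := (tendsto_factorial_mul_choose_div d 1 b a ha).add
    ((tendsto_factorial_mul_choose_div d a b a ha).const_mul ((n * e : ℕ) : ℝ))
  have hle := le_of_tendsto_of_tendsto' h2 h1 fun k ↦ by
    have hk : ((k.choose d : ℝ) + n * e * ((a * k).choose d : ℝ)) ≤ n * f (a * k + b) := by
      exact_mod_cast h k
    have := mul_le_mul_of_nonneg_left hk
      (show 0 ≤ (d.factorial : ℝ) / ((a * k + b : ℕ) : ℝ) ^ d by positivity)
    simp only [Function.comp_apply, one_mul]
    push_cast at this ⊢
    calc _ = _ := ?_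
      _ ≤ _ := this
      _ = _ := ?_
    all_goals ring
  have ha' : (a : ℝ) ≠ 0 := by exact_mod_cast ha
  have hpos : (0 : ℝ) < ((1 : ℕ) / a : ℝ) ^ d := by positivity
  rw [div_self ha', one_pow, mul_one] at hle
  push_cast at hle hpos
  linarith

end Asymptotics

/-! ### Direct sums and minimal generators -/

section Pi

variable {R : Type*} [CommRing R] {M : Type*} [AddCommGroup M] [Module R M]

/-- The quotient `Mⁿ / I Mⁿ` is `(M / I M)ⁿ`. -/
noncomputable def piQuotSMulTopEquiv (I : Ideal R) (n : ℕ) :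
    ((Fin n → M) ⧸ (I • ⊤ : Submodule R (Fin n → M))) ≃ₗ[R]
      (Fin n → M ⧸ (I • ⊤ : Submodule R M)) :=
  (TensorProduct.quotTensorEquivQuotSMul _ I).symm ≪≫ₗ
    TensorProduct.piRight R R (R ⧸ I) (fun _ : Fin n ↦ M) ≪≫ₗ
    LinearEquiv.piCongrRight fun _ ↦ TensorProduct.quotTensorEquivQuotSMul M I

lemma samuel_pi [IsLocalRing R] (n k : ℕ) :
    samuel R (Fin n → M) k = n * samuel R M k := by
  rw [samuel, (piQuotSMulTopEquiv _ n).length_eq, Module.length_pi_of_fintype]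
  simp [samuel]

/-- The annihilator of a tuple is the intersection of those of its coordinates; a prime that is such
a finite intersection equals one of them. -/
lemma associatedPrimes_pi_subset [IsNoetherianRing R] (n : ℕ) :
    associatedPrimes R (Fin n → M) ⊆ associatedPrimes R M := by
  intro p hp
  obtain ⟨hp, x, hx⟩ := isAssociatedPrime_iff.mp hp
  have hle : Finset.univ.inf (fun i ↦ (⊥ : Submodule R M).colon {x i}) ≤ p := by
    intro r hr
    rw [hx, Submodule.mem_colon_singleton, Submodule.mem_bot]
    funext i
    have := (Finset.inf_le (f := fun i ↦ (⊥ : Submodule R M).colon {x i}) (Finset.mem_univ i)) hr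
    rwa [Submodule.mem_colon_singleton, Submodule.mem_bot] at this
  obtain ⟨i, -, hi⟩ := hp.inf_le'.mp hle
  refine isAssociatedPrime_iff.mpr ⟨hp, x i, le_antisymm (fun r hr ↦ ?_) hi⟩
  rw [hx, Submodule.mem_colon_singleton, Submodule.mem_bot] at hr
  rw [Submodule.mem_colon_singleton, Submodule.mem_bot]
  exact congr_fun hr i

end Pi

section Generators

variable {R : Type*} [CommRing R] (X : Type*) [AddCommGroup X] [Module R X]
  [Module.Finite R X]

lemma exists_surjective_of_minGens :
    ∃ φ : (Fin (minGens R X) → R) →ₗ[R] X, Function.Surjective φ := by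
  obtain ⟨s, hs, hspan⟩ :=
    (Module.Finite.fg_top (R := R) (M := X)).exists_span_finset_card_eq_spanFinrank
  let e : Fin (minGens R X) ≃ s := (s.equivFinOfCardEq hs).symm
  refine ⟨Fintype.linearCombination R fun i ↦ (e i : X), LinearMap.range_eq_top.mp ?_⟩
  rw [Fintype.range_linearCombination, ← hspan]
  congr 1
  ext x
  constructor
  · rintro ⟨i, rfl⟩
    exact (e i).2
  · exact fun hx ↦ ⟨e.symm ⟨x, hx⟩, by simp⟩

variable [IsLocalRing R]

lemma finrank_quotient_eq_minGens :
    Module.finrank (R ⧸ maximalIdeal R) (X ⧸ (maximalIdeal R • ⊤ : Submodule R X)) =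
      minGens R X := by
  rw [minGens, spanFinrank_eq_finrank_quotient _ Module.Finite.fg_top]
  let e : X ≃ₗ[R] (⊤ : Submodule R X) := Submodule.topEquiv.symm
  let e' := (Submodule.Quotient.equiv (maximalIdeal R • ⊤ : Submodule R X)
    (maximalIdeal R • ⊤ : Submodule R (⊤ : Submodule R X)) e (by
      rw [Submodule.map_smul'', Submodule.map_top]
      congr 1
      exact LinearMap.range_eq_top.mpr e.surjective))
  exact (e'.extendScalarsOfSurjective Ideal.Quotient.mk_surjective).finrank_eq

lemma length_quotient_eq_minGens :
    Module.length R (X ⧸ (maximalIdeal R • ⊤ : Submodule R X)) = minGens R X := by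
  let : Field (R ⧸ maximalIdeal R) := Ideal.Quotient.field _
  have : Module.Finite (R ⧸ maximalIdeal R) (X ⧸ (maximalIdeal R • ⊤ : Submodule R X)) :=
    Module.Finite.of_restrictScalars_finite R _ _
  rw [← finrank_quotient_eq_minGens, ← Module.length_eq_finrank]
  exact Module.length_eq_of_surjective Ideal.Quotient.mk_surjective

lemma samuel_one_eq_minGens : samuel R X 1 = minGens R X := by
  rw [samuel, pow_one, length_quotient_eq_minGens]

/-- `X / 𝔪 X` is a direct sum of `μ(X)` copies of `R / 𝔪`. -/
lemma nonempty_quotient_equiv_pi :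
    Nonempty ((X ⧸ (maximalIdeal R • ⊤ : Submodule R X)) ≃ₗ[R]
      (Fin (minGens R X) → R ⧸ maximalIdeal R)) := by
  let : Field (R ⧸ maximalIdeal R) := Ideal.Quotient.field _
  have : Module.Finite (R ⧸ maximalIdeal R) (X ⧸ (maximalIdeal R • ⊤ : Submodule R X)) :=
    Module.Finite.of_restrictScalars_finite R _ _
  exact ⟨(Module.finBasisOfFinrankEq (R ⧸ maximalIdeal R) _
    (finrank_quotient_eq_minGens X)).equivFun.restrictScalars R⟩

/-- Reducing `M ⊗ X` modulo `𝔪` gives `M ⊗ (X/𝔪X)`, a sum of `μ(X)` copies of `M/𝔪M`. -/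
lemma samuel_one_tensorProduct (M : Type*) [AddCommGroup M] [Module R M] :
    samuel R (M ⊗[R] X) 1 = minGens R X * samuel R M 1 := by
  obtain ⟨e⟩ := nonempty_quotient_equiv_pi (R := R) X
  have e' := (TensorProduct.quotTensorEquivQuotSMul (M ⊗[R] X) (maximalIdeal R)).symm ≪≫ₗ
    TensorProduct.leftComm R _ M X ≪≫ₗ
    (TensorProduct.quotTensorEquivQuotSMul X (maximalIdeal R) ≪≫ₗ e).lTensor M ≪≫ₗ
    TensorProduct.piRight R R M (fun _ : Fin (minGens R X) ↦ R ⧸ maximalIdeal R) ≪≫ₗ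
    LinearEquiv.piCongrRight fun _ ↦ TensorProduct.tensorQuotEquivQuotSMul M (maximalIdeal R)
  rw [samuel, samuel, pow_one, e'.length_eq, Module.length_pi_of_fintype]
  simp

end Generators

/-! ### Injectivity of surjections from `Mⁿ` -/

section Comparison

variable {R : Type u} [CommRing R] [IsLocalRing R] [IsNoetherianRing R]
  {M : Type*} [AddCommGroup M] [Module R M] [Module.Finite R M]

lemma supportDim_eq_natDim (X : Type*) [AddCommGroup X] [Module R X] [Nontrivial X] :
    Module.supportDim R X = natDim R X := by
  have h1 : Module.supportDim R X ≠ ⊥ := Module.supportDim_ne_bot_of_nontrivial R X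
  have h2 : Module.supportDim R X ≠ ⊤ :=
    ((Module.supportDim_le_ringKrullDim R X).trans_lt ringKrullDim_lt_top).ne
  rw [natDim]
  generalize Module.supportDim R X = x at *
  induction x with
  | bot => exact absurd rfl h1
  | coe x =>
    induction x with
    | top => exact absurd rfl h2
    | coe x => simp

lemma exists_isWeaklyRegular_of_isCohenMacaulay {X : Type*} [AddCommGroup X] [Module R X]
    [Nontrivial X] (hX : IsCohenMacaulay R X) :
    ∃ rs : List R, rs.length = natDim R X ∧ (∀ r ∈ rs, r ∈ maximalIdeal R) ∧
      IsWeaklyRegular X rs := by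
  have hd : depth R X = natDim R X := by
    have h := hX.resolve_left (not_subsingleton X)
    rw [supportDim_eq_natDim] at h
    exact_mod_cast h
  obtain ⟨rs, hlen, hm, hrs⟩ : ∃ rs : List R, natDim R X ≤ rs.length ∧
      (∀ r ∈ rs, r ∈ maximalIdeal R) ∧ IsWeaklyRegular X rs := by
    -- The supremum defining depth exceeds `natDim R X - 1`, so some sequence is long enough.
    -- Dimension zero is separate because the subtraction truncates.
    rcases Nat.eq_zero_or_pos (natDim R X) with h0 | hpos
    · exact ⟨[], h0.le, by simp, by simp⟩
    · have hlt : ((natDim R X - 1 : ℕ) : ℕ∞) < depth R X := by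
        rw [hd]
        exact_mod_cast Nat.sub_lt hpos one_pos
      rw [depth] at hlt
      simp only [lt_iSup_iff] at hlt
      obtain ⟨rs, ⟨h1, h2⟩, h3⟩ := hlt
      refine ⟨rs, ?_, h1, h2⟩
      have : natDim R X - 1 < rs.length := by exact_mod_cast h3
      lia
  refine ⟨rs.take (natDim R X), by simpa using hlen, fun r hr ↦ hm r (List.mem_of_mem_take hr), ?_⟩
  rw [← List.take_append_drop (natDim R X) rs] at hrs
  exact ((isWeaklyRegular_append_iff X _ _).mp hrs).1

lemma exists_choose_le_samuel_quotient {p : Ideal R} [p.IsPrime] {d : ℕ}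
    (hd : (d : WithBot ℕ∞) ≤ ringKrullDim (R ⧸ p)) :
    ∃ c : ℕ, ∀ k, (k.choose d : ℕ∞) ≤ samuel R (R ⧸ p) (c * k + c) := by
  obtain ⟨l, hl⟩ := Order.le_krullDim_iff.mp hd
  have hmono : StrictMono (PrimeSpectrum.comap (Ideal.Quotient.mk p)) :=
    Monotone.strictMono_of_injective (fun _ _ h ↦ Ideal.comap_mono h)
      (PrimeSpectrum.comap_injective_of_surjective _ Ideal.Quotient.mk_surjective)
  obtain ⟨c, hc⟩ := exists_choose_le_samuel_quotient_prime d (l.map _ hmono) hl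
  have hle : p ≤ (l.map _ hmono).head.asIdeal := by
    intro r hr
    change Ideal.Quotient.mk p r ∈ l.head.asIdeal
    rw [Ideal.Quotient.eq_zero_iff_mem.mpr hr]
    exact zero_mem _
  exact ⟨c, fun k ↦ (hc k).trans
    (samuel_le_of_surjective (Submodule.factor hle) (Submodule.factor_surjective _) _)⟩

/-- A copy `Rx` of `R ⧸ p` lies in `ker ψ`. Artin-Rees compares its `𝔪`-adic filtration with the one
induced from `Y`, so its image in `Y / 𝔪 ^ (k + c) Y` still maps onto `(R ⧸ p) / 𝔪ᵏ`, and this image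
dies in `X`. -/
lemma exists_samuel_add_samuel_le {X Y : Type*} [AddCommGroup X] [Module R X] [AddCommGroup Y]
    [Module R Y] [Module.Finite R Y] (ψ : Y →ₗ[R] X) (hψ : Function.Surjective ψ) {p : Ideal R}
    (hp : IsAssociatedPrime p (LinearMap.ker ψ)) :
    ∃ c, ∀ k, samuel R (R ⧸ p) k + samuel R X (k + c) ≤ samuel R Y (k + c) := by
  obtain ⟨hp, x, hx⟩ := isAssociatedPrime_iff.mp hp
  set f : R →ₗ[R] Y := LinearMap.toSpanSingleton R Y x
  have hker : LinearMap.ker f = p := by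
    ext r
    rw [hx, Submodule.mem_colon_singleton, Submodule.mem_bot, LinearMap.mem_ker]
    simp [f, ← Subtype.val_inj]
  obtain ⟨c, hc⟩ := exists_mem_sup_ker_of_apply_mem_pow f
  refine ⟨c, fun k ↦ ?_⟩
  set J : Submodule R R := (maximalIdeal R ^ (k + c) • ⊤ : Submodule R Y).comap f
  have hJ : J ≤ (maximalIdeal R ^ k • ⊤ : Submodule R (R ⧸ p)).comap (Submodule.mkQ p) := by
    intro r hr
    obtain ⟨s, hs, t, ht, rfl⟩ := Submodule.mem_sup.mp (hc k r hr)
    rw [hker] at ht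
    rw [Submodule.mem_comap, map_add, Submodule.mkQ_apply p t,
      (Submodule.Quotient.mk_eq_zero p).mpr ht, add_zero]
    exact Submodule.smul_top_le_comap_smul_top _ (Submodule.mkQ p) hs
  refine le_trans (add_le_add_left (Module.length_le_of_surjective (Submodule.mapQ J _ _ hJ)
    (mapQ_surjective (Submodule.mkQ_surjective p))) _) (length_add_length_le
    (Submodule.mapQ J _ f le_rfl)
    (Submodule.mapQ _ _ ψ (Submodule.smul_top_le_comap_smul_top _ _)) ?_ (mapQ_surjective hψ) ?_)
  · rw [← LinearMap.ker_eq_bot, Submodule.ker_mapQ]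
    exact Submodule.mkQ_map_self _
  · refine LinearMap.ext fun q ↦ ?_
    obtain ⟨r, rfl⟩ := Submodule.Quotient.mk_surjective _ q
    have h0 : ψ (f r) = 0 := (map_smul ψ r (x : Y)).trans (by rw [x.2, smul_zero])
    exact congrArg Submodule.Quotient.mk h0

/-- If `e(M) = μ(M)` and `M` is unmixed, a surjection from `Mⁿ` to a Cohen-Macaulay module of
the same dimension that needs `n · μ(M)` generators is injective. -/
theorem injective_of_isUnmixed [Nontrivial M] (hunmixed : IsUnmixed R M)
    (hmult : HasMultiplicity M (maximalIdeal R) (minGens R M : ℝ)) {X : Type u} [AddCommGroup X]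
    [Module R X] [Module.Finite R X] (hdim : Module.supportDim R M = Module.supportDim R X)
    (hCM : IsCohenMacaulay R X) {n : ℕ} (hgen : samuel R X 1 = n * minGens R M)
    (ψ : (Fin n → M) →ₗ[R] X) (hψ : Function.Surjective ψ) : Function.Injective ψ := by
  by_contra hinj
  have : Nontrivial (LinearMap.ker ψ) :=
    Submodule.nontrivial_iff_ne_bot.mpr fun h ↦ hinj (LinearMap.ker_eq_bot.mp h)
  obtain ⟨p, hp⟩ := associatedPrimes.nonempty R (LinearMap.ker ψ)
  have hpM : p ∈ assh R M := hunmixed ▸ associatedPrimes_pi_subset n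
    (associatedPrimes.subset_of_injective (Submodule.subtype_injective _) hp)
  have hprime : p.IsPrime := IsAssociatedPrime.isPrime hp
  have : Nontrivial X := by
    rw [← Module.supportDim_ne_bot_iff_nontrivial R, ← hdim]
    exact Module.supportDim_ne_bot_of_nontrivial R M
  have hnat : natDim R X = natDim R M := by rw [natDim, natDim, hdim]
  obtain ⟨rs, hlen, hm, hrs⟩ := exists_isWeaklyRegular_of_isCohenMacaulay hCM
  obtain ⟨c₁, h₁⟩ := exists_choose_le_samuel_quotient (p := p) (d := natDim R M)
    (by rw [hpM.2, supportDim_eq_natDim])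
  obtain ⟨c₂, h₂⟩ := exists_samuel_one_mul_choose_le hm hrs
  obtain ⟨c₃, h₃⟩ := exists_samuel_add_samuel_le ψ hψ hp
  rw [hlen, hgen, hnat] at h₂
  -- The slope `c₁ + 1` is nonzero and dominates the rescaling for `R ⧸ p`. The offset collects the
  -- constant of that rescaling, the shift in the bound for `X` and the Artin-Rees shift.
  refine not_forall_choose_add_le (f := fun k ↦ (samuel R M k).toNat) (a := c₁ + 1)
    (b := c₁ + c₂ + c₃) (n := n) (e := minGens R M) (d := natDim R M) (by lia) hmult fun k ↦ ?_
  have h := le_trans (add_le_add ((h₁ k).trans (samuel_mono R _ (show c₁ * k + c₁ ≤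
    (c₁ + 1) * k + c₁ + c₂ by nlinarith))) ((h₂ ((c₁ + 1) * k)).trans (samuel_mono R _ (by lia))))
    (h₃ ((c₁ + 1) * k + c₁ + c₂))
  rw [samuel_pi, ← ENat.natCast_toNat (samuel_ne_top M _)] at h
  rw [show (c₁ + 1) * k + (c₁ + c₂ + c₃) = (c₁ + 1) * k + c₁ + c₂ + c₃ by ring]
  exact_mod_cast h

end Comparison

open IsLocalRing RingTheory.Sequence
open scoped Pointwise

/-! ### Invariants of direct sums of copies of `M` -/

section DirectSums

variable {R : Type*} [CommRing R]

lemma isSMulRegular_pi_iff {M : Type*} [AddCommGroup M] [Module R M] {n : ℕ} (hn : n ≠ 0) (r : R) :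
    IsSMulRegular (Fin n → M) r ↔ IsSMulRegular M r := by
  constructor
  · intro h x y hxy
    have h1 : (fun _ : Fin n ↦ x) = fun _ ↦ y := h (funext fun _ ↦ hxy)
    exact congr_fun h1 ⟨0, Nat.pos_of_ne_zero hn⟩
  · intro h x y hxy
    exact funext fun i ↦ h (congr_fun hxy i)

lemma isWeaklyRegular_pi_iff {n : ℕ} (hn : n ≠ 0) (rs : List R) :
    ∀ (M : Type v) [AddCommGroup M] [Module R M],
      IsWeaklyRegular (Fin n → M) rs ↔ IsWeaklyRegular M rs := by
  induction rs with
  | nil => simp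
  | cons r rs ih =>
    intro M _ _
    rw [isWeaklyRegular_cons_iff, isWeaklyRegular_cons_iff, isSMulRegular_pi_iff hn,
      ← ih (QuotSMulTop r M)]
    have e : QuotSMulTop r (Fin n → M) ≃ₗ[R] (Fin n → QuotSMulTop r M) :=
      Submodule.quotEquivOfEq _ _ (Submodule.ideal_span_singleton_smul r ⊤).symm ≪≫ₗ
        piQuotSMulTopEquiv _ n ≪≫ₗ LinearEquiv.piCongrRight fun _ ↦
          Submodule.quotEquivOfEq _ _ (Submodule.ideal_span_singleton_smul r ⊤)
    rw [e.isWeaklyRegular_congr]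

variable {M : Type*} [AddCommGroup M] [Module R M] {X : Type*} [AddCommGroup X] [Module R X]
  {n : ℕ} (e : X ≃ₗ[R] (Fin n → M)) (hn : n ≠ 0)

include e hn

lemma depth_eq_of_equiv_pi [IsLocalRing R] : depth R X = depth R M := by
  simp_rw [depth, e.isWeaklyRegular_congr, isWeaklyRegular_pi_iff hn]

lemma supportDim_eq_of_equiv_pi [Module.Finite R M] :
    Module.supportDim R X = Module.supportDim R M := by
  have : Module.annihilator R (Fin n → M) = Module.annihilator R M := by
    ext r
    simp only [Module.mem_annihilator]
    constructor
    · intro h m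
      exact congr_fun (h fun _ ↦ m) ⟨0, Nat.pos_of_ne_zero hn⟩
    · intro h m
      exact funext fun i ↦ h (m i)
  rw [Module.supportDim_eq_of_equiv e, Module.supportDim_eq_ringKrullDim_quotient_annihilator,
    Module.supportDim_eq_ringKrullDim_quotient_annihilator, this]

lemma isCohenMacaulay_iff_of_equiv_pi [IsLocalRing R] [Module.Finite R M] [Nontrivial M] :
    IsCohenMacaulay R X ↔ IsCohenMacaulay R M := by
  have : NeZero n := ⟨hn⟩
  have hX : ¬ Subsingleton X := fun _ ↦ not_subsingleton (Fin n → M) e.symm.toEquiv.subsingleton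
  have hM : ¬ Subsingleton M := not_subsingleton M
  rw [IsCohenMacaulay, IsCohenMacaulay, depth_eq_of_equiv_pi e hn, supportDim_eq_of_equiv_pi e hn]
  tauto

omit hn

/-- A finite direct sum of copies of a Cohen-Macaulay module `M` with `e(M) = μ(M)` is Ulrich. -/
theorem isUlrich_of_equiv_pi [IsLocalRing R] [Module.Finite R M] [Nontrivial M]
    (hCM : IsCohenMacaulay R M)
    (hmult : HasMultiplicity M (maximalIdeal R) (minGens R M : ℝ)) : IsUlrich R X := by
  have hlen (k : ℕ) : (Module.length R (X ⧸ (maximalIdeal R ^ k • ⊤ : Submodule R X))).toNat =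
      n * (Module.length R (M ⧸ (maximalIdeal R ^ k • ⊤ : Submodule R M))).toNat := by
    change (samuel R X k).toNat = n * (samuel R M k).toNat
    rw [samuel_congr e, samuel_pi]
    simp
  refine ⟨?_, ?_, n * minGens R M, ?_, ?_⟩
  · rcases eq_or_ne n 0 with rfl | hn
    · exact Or.inl e.toEquiv.subsingleton
    · exact (isCohenMacaulay_iff_of_equiv_pi e hn).mpr hCM
  · let : Field (R ⧸ maximalIdeal R) := Ideal.Quotient.field _
    exact Module.Free.of_divisionRing _ _
  -- For `n = 0` the dimensions of `X` and `M` need not agree, but all lengths vanish and the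
  -- multiplicity is `0`.
  · rcases eq_or_ne n 0 with rfl | hn
    · simp [HasMultiplicity, hlen]
    · have hd : natDim R X = natDim R M := by
        rw [natDim, natDim, supportDim_eq_of_equiv_pi e hn]
      refine (hmult.const_mul (n : ℝ)).congr fun k ↦ ?_
      rw [hlen, hd]
      push_cast
      ring
  · have h1 := hlen 1
    rw [pow_one, length_quotient_eq_minGens M] at h1
    rw [h1]
    simp

end DirectSums

/-! ### Kernels contained in `Ann(M)` times the source -/

section Annihilator

variable {R : Type*} [CommRing R] {M P Q : Type*} [AddCommGroup M] [Module R M]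
  [AddCommGroup P] [Module R P] [AddCommGroup Q] [Module R Q]

lemma tmul_eq_zero_of_mem_annihilator_smul (m : M) {y : P}
    (hy : y ∈ (Module.annihilator R M • ⊤ : Submodule R P)) : m ⊗ₜ[R] y = 0 := by
  induction hy using Submodule.smul_induction_on' with
  | smul r hr y _ =>
    rw [← TensorProduct.smul_tmul, Module.mem_annihilator.mp hr, TensorProduct.zero_tmul]
  | add y _ z _ h1 h2 => rw [TensorProduct.tmul_add, h1, h2, add_zero]

/-- The kernel is the image of `M ⊗ ker φ`, and scalars from `Ann(M)` cross the tensor sign to kill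
it. -/
lemma lTensor_injective_of_ker_le {φ : P →ₗ[R] Q} (hφ : Function.Surjective φ)
    (hker : LinearMap.ker φ ≤ Module.annihilator R M • ⊤) :
    Function.Injective (φ.lTensor M) := by
  have hz : (LinearMap.ker φ).subtype.lTensor M = 0 :=
    TensorProduct.ext' fun m y ↦ tmul_eq_zero_of_mem_annihilator_smul m (hker y.2)
  rw [injective_iff_map_eq_zero]
  intro x hx
  obtain ⟨y, rfl⟩ := (lTensor_exact M (LinearMap.exact_subtype_ker_map φ) hφ x).mp hx
  rw [hz, LinearMap.zero_apply]

/-- Converse for a free source: under `M ⊗ Rⁿ ≅ Mⁿ`, the vanishing of every `m ⊗ y` says that each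
coordinate of `y` kills `M`. -/
lemma ker_le_annihilator_smul {n : ℕ} {φ : (Fin n → R) →ₗ[R] Q}
    (hφ : Function.Injective (φ.lTensor M)) :
    LinearMap.ker φ ≤ Module.annihilator R M • ⊤ := by
  intro y hy
  have hm (m : M) : m ⊗ₜ[R] y = 0 := hφ (by
    rw [LinearMap.lTensor_tmul, LinearMap.mem_ker.mp hy, TensorProduct.tmul_zero, map_zero])
  rw [pi_eq_sum_univ' y]
  refine Submodule.sum_mem _ fun i _ ↦ Submodule.smul_mem_smul ?_ Submodule.mem_top
  refine Module.mem_annihilator.mpr fun m ↦ ?_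
  have h := congrArg (TensorProduct.piScalarRight R R M (Fin n)) (hm m)
  simpa using congr_fun h i

end Annihilator

section Multilinear

variable {R ι : Type*} [CommRing R] {F N : ι → Type*} [∀ i, AddCommGroup (F i)]
  [∀ i, Module R (F i)] [∀ i, AddCommGroup (N i)] [∀ i, Module R (N i)] {P : Type*}
  [AddCommGroup P] [Module R P] {φ : ∀ i, F i →ₗ[R] N i}

/-- Replace the arguments one at a time; each difference is a value with one argument in a kernel.
-/
lemma multilinearMap_apply_eq [Finite ι] {f : MultilinearMap R F P}
    (hf : ∀ v i, φ i (v i) = 0 → f v = 0) {v w : ∀ i, F i} (h : ∀ i, φ i (v i) = φ i (w i)) :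
    f v = f w := by
  classical
  have := Fintype.ofFinite ι
  have key (s : Finset ι) : f (s.piecewise v w) = f w := by
    induction s using Finset.induction_on with
    | empty => simp
    | insert j s hj ih =>
      rw [Finset.piecewise_insert, ← ih, ← sub_eq_zero]
      nth_rewrite 2 [← Function.update_eq_self j (s.piecewise v w)]
      rw [← f.map_update_sub]
      refine hf _ j ?_
      rw [Function.update_self, map_sub, Finset.piecewise_eq_of_notMem _ _ _ hj, h, sub_self]
  simpa using key Finset.univ

/-- A multilinear map that vanishes as soon as one argument lies in the kernel of `φ i`
descends along the surjections `φ i`. -/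
lemma exists_multilinearMap_comp_eq [Finite ι] (hφ : ∀ i, Function.Surjective (φ i))
    {f : MultilinearMap R F P} (hf : ∀ v i, φ i (v i) = 0 → f v = 0) :
    ∃ g : MultilinearMap R N P, ∀ v, g (fun i ↦ φ i (v i)) = f v := by
  let s (x : ∀ i, N i) : ∀ i, F i := fun i ↦ Function.surjInv (hφ i) (x i)
  have hs (x : ∀ i, N i) (i : ι) : φ i (s x i) = x i := Function.surjInv_eq (hφ i) (x i)
  have hupd [DecidableEq ι] (x : ∀ i, N i) (i : ι) (a : N i) (b : F i) (hb : φ i b = a) :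
      f (s (Function.update x i a)) = f (Function.update (s x) i b) := by
    refine multilinearMap_apply_eq hf fun j ↦ ?_
    rw [hs]
    rcases eq_or_ne j i with rfl | hj
    · simp [hb]
    · simp [hj, hs]
  refine ⟨⟨fun x ↦ f (s x), fun x i a b ↦ ?_, fun x i c a ↦ ?_⟩, fun v ↦ ?_⟩
  · obtain ⟨a, rfl⟩ := hφ i a
    obtain ⟨b, rfl⟩ := hφ i b
    rw [hupd x i _ (a + b) (map_add _ _ _), hupd x i _ a rfl, hupd x i _ b rfl, f.map_update_add]
  · obtain ⟨a, rfl⟩ := hφ i a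
    rw [hupd x i _ (c • a) (map_smul _ _ _), hupd x i _ a rfl, f.map_update_smul]
  · exact multilinearMap_apply_eq hf fun i ↦ hs (fun i ↦ φ i (v i)) i

variable {I : Ideal R}

lemma multilinearMap_mem_smul_top (f : MultilinearMap R F P) {v : ∀ i, F i} {i : ι}
    (hv : v i ∈ (I • ⊤ : Submodule R (F i))) : f v ∈ (I • ⊤ : Submodule R P) := by
  classical
  have h := Submodule.smul_top_le_comap_smul_top I (f.toLinearMap v i) hv
  rwa [Submodule.mem_comap, MultilinearMap.toLinearMap_apply, Function.update_eq_self] at h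

/-- Modulo `I`, the universal multilinear map vanishes when an argument lies in some `ker (φ i)`, so
it descends to the `N i`. Thus reduction modulo `I` factors through `PiTensorProduct.map φ`, which
bounds the kernel without computing it. -/
lemma ker_piTensorProduct_map_le [Finite ι] (hφ : ∀ i, Function.Surjective (φ i))
    (hker : ∀ i, LinearMap.ker (φ i) ≤ I • ⊤) :
    LinearMap.ker (PiTensorProduct.map φ) ≤ I • ⊤ := by
  obtain ⟨g, hg⟩ := exists_multilinearMap_comp_eq hφ
    (f := (I • ⊤ : Submodule R (PiTensorProduct R F)).mkQ.compMultilinearMap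
      (PiTensorProduct.tprod R)) fun v i hv ↦ (Submodule.Quotient.mk_eq_zero _).mpr
        (multilinearMap_mem_smul_top _ (hker i hv))
  have hcomp : PiTensorProduct.lift g ∘ₗ PiTensorProduct.map φ =
      (I • ⊤ : Submodule R (PiTensorProduct R F)).mkQ := by
    ext v
    simpa using hg v
  intro x hx
  have h := congr($hcomp x)
  rw [LinearMap.comp_apply, LinearMap.mem_ker.mp hx, map_zero] at h
  exact (Submodule.Quotient.mk_eq_zero _).mp h.symm

lemma piTensorProduct_map_surjective (hφ : ∀ i, Function.Surjective (φ i)) :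
    Function.Surjective (PiTensorProduct.map φ) := by
  rw [← LinearMap.range_eq_top, ← top_le_iff, ← PiTensorProduct.span_tprod_eq_top,
    Submodule.span_le]
  rintro _ ⟨x, rfl⟩
  choose v hv using fun i ↦ hφ i (x i)
  exact ⟨PiTensorProduct.tprod R v, by simp [PiTensorProduct.map_tprod, hv]⟩

lemma ker_exteriorPower_map_le {A B : Type*} [AddCommGroup A] [Module R A] [AddCommGroup B]
    [Module R B] {φ : A →ₗ[R] B} (hφ : Function.Surjective φ) (hker : LinearMap.ker φ ≤ I • ⊤)
    (r : ℕ) : LinearMap.ker (exteriorPower.map r φ) ≤ I • ⊤ := by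
  obtain ⟨g, hg⟩ := exists_multilinearMap_comp_eq (φ := fun _ : Fin r ↦ φ) (fun _ ↦ hφ)
    (f := ((I • ⊤ : Submodule R (⋀[R]^r A)).mkQ.compAlternatingMap
      (exteriorPower.ιMulti R r)).toMultilinearMap) fun v i hv ↦
        (Submodule.Quotient.mk_eq_zero _).mpr (multilinearMap_mem_smul_top
          (exteriorPower.ιMulti R r).toMultilinearMap (hker hv))
  -- The descended map is alternating because a fixed section of `φ` lifts equal arguments to equal
  -- arguments.
  let g' : B [⋀^Fin r]→ₗ[R] (⋀[R]^r A ⧸ (I • ⊤ : Submodule R (⋀[R]^r A))) :=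
    { g with
      map_eq_zero_of_eq' := by
        intro x i j hij hne
        have hs (y : B) : φ (Function.surjInv hφ y) = y := Function.surjInv_eq hφ y
        have h := hg fun i ↦ Function.surjInv hφ (x i)
        simp only [hs] at h
        exact h.trans (AlternatingMap.map_eq_zero_of_eq _ _ (congrArg _ hij) hne) }
  have hcomp : exteriorPower.alternatingMapLinearEquiv g' ∘ₗ exteriorPower.map r φ =
      (I • ⊤ : Submodule R (⋀[R]^r A)).mkQ := by
    refine exteriorPower.linearMap_ext (AlternatingMap.ext fun v ↦ ?_)
    simp only [LinearMap.compAlternatingMap_apply, LinearMap.comp_apply,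
      exteriorPower.map_apply_ιMulti, exteriorPower.alternatingMapLinearEquiv_apply_ιMulti]
    exact hg v
  intro x hx
  have h := congr($hcomp x)
  rw [LinearMap.comp_apply, LinearMap.mem_ker.mp hx, map_zero] at h
  exact (Submodule.Quotient.mk_eq_zero _).mp h.symm

end Multilinear

section Free

variable {R ι : Type*} [CommRing R] [Finite ι]

instance free_piTensorProduct {F : ι → Type*} [∀ i, AddCommGroup (F i)] [∀ i, Module R (F i)]
    [∀ i, Module.Free R (F i)] : Module.Free R (PiTensorProduct R F) :=
  Module.Free.of_basis (Basis.piTensorProduct fun i ↦ Module.Free.chooseBasis R (F i))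

lemma exists_tensorProduct_equiv_pi [Nontrivial R] (M P : Type*) [AddCommGroup M] [Module R M]
    [AddCommGroup P] [Module R P] [Module.Free R P] [Module.Finite R P] :
    ∃ n, Nonempty (M ⊗[R] P ≃ₗ[R] (Fin n → M)) :=
  ⟨_, ⟨(Module.finBasis R P).equivFun.lTensor M ≪≫ₗ TensorProduct.piScalarRight R R M _⟩⟩

/-- Tensor `y ∈ ker (φ i)` with a basis vector of each other factor, available since `n j ≠ 0`. The
result is killed, hence zero, and its coordinates include those of `y`. -/
lemma injective_of_injective_piTensorProduct_map {N : ι → Type*} [∀ i, AddCommGroup (N i)]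
    [∀ i, Module R (N i)] {n : ι → ℕ} (hn : ∀ i, n i ≠ 0) {φ : ∀ i, (Fin (n i) → R) →ₗ[R] N i}
    (h : Function.Injective (PiTensorProduct.map φ)) (i : ι) : Function.Injective (φ i) := by
  classical
  have := Fintype.ofFinite ι
  let c (j : ι) : Fin (n j) := ⟨0, Nat.pos_of_ne_zero (hn j)⟩
  rw [injective_iff_map_eq_zero]
  intro y hy
  let v : ∀ j, Fin (n j) → R := Function.update (fun j ↦ Pi.single (c j) 1) i y
  have hv : PiTensorProduct.tprod R v = 0 := by
    refine h ?_
    rw [map_zero, PiTensorProduct.map_tprod]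
    exact MultilinearMap.map_coord_zero _ i (by simp [v, hy])
  funext l
  have h1 := congr(Basis.piTensorProduct (fun j ↦ Pi.basisFun R (Fin (n j))) |>.repr $hv
    (Function.update c i l))
  rw [Basis.piTensorProduct_repr_tprod_apply, Finset.prod_eq_single i] at h1
  · simpa [v] using h1
  · intro j _ hj
    simp [v, hj]
  · simp

end Free

open IsLocalRing

/-! ### Vanishing of `Tor₁` as injectivity on the kernel of a presentation -/

section Tor

lemma lTensor_ker_subtype_injective_of_exact {R M A B C Q : Type*} [CommRing R] [AddCommGroup M]
    [Module R M] [AddCommGroup A] [Module R A] [AddCommGroup B] [Module R B] [AddCommGroup C]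
    [Module R C] [AddCommGroup Q] [Module R Q] {f : A →ₗ[R] B} {g : B →ₗ[R] C} {π : C →ₗ[R] Q}
    (hfg : g ∘ₗ f = 0) (hg : Function.Exact g π)
    (hM : Function.Exact (f.lTensor M) (g.lTensor M)) :
    Function.Injective ((LinearMap.ker π).subtype.lTensor M) := by
  -- An element of `M ⊗ ker π` that dies in `M ⊗ C` lifts to a cycle in `M ⊗ B`, hence to a
  -- boundary, and boundaries vanish in `M ⊗ ker π`.
  let g' : B →ₗ[R] LinearMap.ker π := g.codRestrict _ fun b ↦ (hg (g b)).mpr ⟨b, rfl⟩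
  have hsub : (LinearMap.ker π).subtype ∘ₗ g' = g := rfl
  have hg' : Function.Surjective g' := fun c ↦ by
    obtain ⟨b, hb⟩ := (hg c).mp c.2
    exact ⟨b, Subtype.ext hb⟩
  have hgf : g' ∘ₗ f = 0 := LinearMap.ext fun a ↦ Subtype.ext congr($hfg a)
  rw [injective_iff_map_eq_zero]
  intro z hz
  obtain ⟨w, rfl⟩ := LinearMap.lTensor_surjective M hg' z
  rw [← LinearMap.lTensor_comp_apply, hsub] at hz
  obtain ⟨a, rfl⟩ := (hM w).mp hz
  rw [← LinearMap.lTensor_comp_apply, hgf, LinearMap.lTensor_zero, LinearMap.zero_apply]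

/-- Whether `M ⊗ -` preserves the injectivity of the kernel of a projective presentation does not
depend on the presentation. -/
lemma lTensor_ker_subtype_injective_of_projective {R M P F Q : Type*} [CommRing R]
    [AddCommGroup M] [Module R M] [AddCommGroup P] [Module R P] [AddCommGroup F] [Module R F]
    [AddCommGroup Q] [Module R Q] [Module.Projective R P] [Module.Projective R F] {π : P →ₗ[R] Q}
    {φ : F →ₗ[R] Q} (hπ : Function.Surjective π) (hφ : Function.Surjective φ)
    (h : Function.Injective ((LinearMap.ker π).subtype.lTensor M)) :
    Function.Injective ((LinearMap.ker φ).subtype.lTensor M) := by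
  obtain ⟨g, hg⟩ := Module.projective_lifting_property π φ hπ
  obtain ⟨k, hk⟩ := Module.projective_lifting_property φ π hφ
  have hg' (x : F) : π (g x) = φ x := congr($hg x)
  have hk' (x : P) : φ (k x) = π x := congr($hk x)
  let g₁ : LinearMap.ker φ →ₗ[R] LinearMap.ker π := g.restrict fun x hx ↦ by
    rw [LinearMap.mem_ker, hg', hx]
  let k₁ : LinearMap.ker π →ₗ[R] LinearMap.ker φ := k.restrict fun x hx ↦ by
    rw [LinearMap.mem_ker, hk', hx]
  -- On `ker φ` the identity differs from `k₁ ∘ g₁` by a map that extends to `F`; after tensoring,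
  -- both summands kill `z`.
  let s : F →ₗ[R] LinearMap.ker φ := (LinearMap.id - k ∘ₗ g).codRestrict _ fun x ↦ by
    simp [hk', hg']
  have hid : s ∘ₗ (LinearMap.ker φ).subtype + k₁ ∘ₗ g₁ = LinearMap.id :=
    LinearMap.ext fun x ↦ Subtype.ext (sub_add_cancel (x : F) (k (g x)))
  rw [injective_iff_map_eq_zero]
  intro z hz
  have hgz : g₁.lTensor M z = 0 := by
    refine h ?_
    rw [map_zero, ← LinearMap.lTensor_comp_apply,
      show (LinearMap.ker π).subtype ∘ₗ g₁ = g ∘ₗ (LinearMap.ker φ).subtype from rfl,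
      LinearMap.lTensor_comp_apply, hz, map_zero]
  have h1 := congr(($hid).lTensor M z)
  rwa [LinearMap.lTensor_add, LinearMap.add_apply, LinearMap.lTensor_comp_apply, hz, map_zero,
    LinearMap.lTensor_comp_apply, hgz, map_zero, zero_add, LinearMap.lTensor_id,
    LinearMap.id_apply, eq_comm] at h1

open CategoryTheory in
lemma lTensor_ker_subtype_injective_of_isZero_tor {R : Type u} [CommRing R] {M Q : Type u}
    [AddCommGroup M] [Module R M] [AddCommGroup Q] [Module R Q]
    (h : Limits.IsZero (((Tor (ModuleCat.{u} R) 1).obj (ModuleCat.of R M)).obj (ModuleCat.of R Q)))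
    {F : Type*} [AddCommGroup F] [Module R F] [Module.Projective R F] {φ : F →ₗ[R] Q}
    (hφ : Function.Surjective φ) : Function.Injective ((LinearMap.ker φ).subtype.lTensor M) := by
  let P := projectiveResolution (ModuleCat.of R Q)
  let T := (MonoidalCategory.tensoringLeft (ModuleCat.{u} R)).obj (ModuleCat.of R M)
  have h0 : Limits.IsZero
      (((T.mapHomologicalComplex (ComplexShape.down ℕ)).obj P.complex).homology 1) :=
    h.of_iso (P.isoLeftDerivedObj T 1).symm
  rw [← HomologicalComplex.exactAt_iff_isZero_homology,
    HomologicalComplex.exactAt_iff' _ 2 1 0 (by simp) (by simp),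
    ShortComplex.moduleCat_exact_iff] at h0
  have hπ : Function.Surjective (P.π.f 0).hom :=
    (ModuleCat.epi_iff_surjective _).mp inferInstance
  have hproj : Module.Projective R (P.complex.X 0) :=
    (IsProjective.iff_projective _).mpr (P.projective 0)
  refine lTensor_ker_subtype_injective_of_projective (π := (P.π.f 0).hom) hπ hφ
    (lTensor_ker_subtype_injective_of_exact (f := (P.complex.d 2 1).hom)
      (g := (P.complex.d 1 0).hom) ?_ ?_ ?_)
  · rw [← ModuleCat.hom_comp, P.complex.d_comp_d]
    rfl
  · exact (ShortComplex.ShortExact.moduleCat_exact_iff_function_exact _).mp P.exact₀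
  · intro x
    constructor
    · exact h0 x
    · rintro ⟨y, rfl⟩
      rw [← LinearMap.lTensor_comp_apply, ← ModuleCat.hom_comp, P.complex.d_comp_d]
      simp

end Tor

/-! ### Nakayama for tensor products and the final assembly -/

section Conclusion

variable {R : Type u} [CommRing R] [IsLocalRing R]

/-- Nakayama, through `μ(M ⊗ K) = μ(M) μ(K)`. -/
lemma subsingleton_of_subsingleton_tensorProduct {M K : Type*} [AddCommGroup M] [Module R M]
    [Module.Finite R M] [Nontrivial M] [AddCommGroup K] [Module R K] [Module.Finite R K]
    [Subsingleton (M ⊗[R] K)] : Subsingleton K := by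
  by_contra hK
  rw [not_subsingleton_iff_nontrivial] at hK
  have h := samuel_one_tensorProduct (R := R) K M
  rw [← samuel_one_eq_minGens, samuel, Module.length_eq_zero, eq_comm, mul_eq_zero] at h
  rcases h with h | h
  · exact absurd (one_le_samuel (R := R) (X := K) one_ne_zero) (by simp [h])
  · exact absurd (one_le_samuel (R := R) (X := M) one_ne_zero) (by simp [h])

lemma minGens_ne_zero (X : Type*) [AddCommGroup X] [Module R X] [Module.Finite R X]
    [Nontrivial X] : minGens R X ≠ 0 := by
  intro h
  have h1 := one_le_samuel (R := R) (X := X) one_ne_zero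
  simp [samuel_one_eq_minGens, h] at h1

variable [IsNoetherianRing R] {M : Type u} [AddCommGroup M] [Module R M] [Module.Finite R M]
  [Nontrivial M]

lemma lTensor_injective_of_isUnmixed (hunmixed : IsUnmixed R M)
    (hmult : HasMultiplicity M (maximalIdeal R) (minGens R M : ℝ)) {N : Type u} [AddCommGroup N]
    [Module R N] [Module.Finite R N] (hdim : Module.supportDim R M = Module.supportDim R (M ⊗[R] N))
    (hCM : IsCohenMacaulay R (M ⊗[R] N)) {φ : (Fin (minGens R N) → R) →ₗ[R] N}
    (hφ : Function.Surjective φ) : Function.Injective (φ.lTensor M) := by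
  let e := TensorProduct.piScalarRight R R M (Fin (minGens R N))
  have h := injective_of_isUnmixed hunmixed hmult hdim hCM (n := minGens R N)
    (by rw [samuel_one_tensorProduct, samuel_one_eq_minGens]) (φ.lTensor M ∘ₗ e.symm.toLinearMap)
    ((LinearMap.lTensor_surjective M hφ).comp e.symm.surjective)
  exact fun x y hxy ↦ e.injective (h (by simpa using hxy))

end Conclusion

end UlrichTensor

open UlrichTensor in
theorem mainTheorem11 (R : Type u) [CommRing R] [IsLocalRing R] [IsNoetherianRing R]
    (M : Type u) [AddCommGroup M] [Module R M] [Module.Finite R M] [Nontrivial M]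
    (t : ℕ) (ht : 1 ≤ t)
    (N : Fin t → Type u) [∀ i, AddCommGroup (N i)] [∀ i, Module R (N i)]
    [∀ i, Module.Finite R (N i)] [∀ i, Nontrivial (N i)]
    (hunmixed : UlrichTensor.IsUnmixed R M)
    (hmult : UlrichTensor.HasMultiplicity M (IsLocalRing.maximalIdeal R)
      (UlrichTensor.minGens R M : ℝ))
    (hdim : ∀ i, Module.supportDim R M = Module.supportDim R (M ⊗[R] N i))
    (hCM : ∀ i, UlrichTensor.IsCohenMacaulay R (M ⊗[R] N i)) :
    Nonempty ((M ⊗[R] (PiTensorProduct R fun i : Fin t =>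
        (Fin (UlrichTensor.minGens R (N i)) → R))) ≃ₗ[R] (M ⊗[R] (PiTensorProduct R N))) ∧
    (UlrichTensor.IsUlrich R (M ⊗[R] (PiTensorProduct R N)) ∧
      ∀ (i : Fin t) (r : ℕ), UlrichTensor.IsUlrich R (M ⊗[R] (⋀[R]^r (N i)))) ∧
    (CategoryTheory.Limits.IsZero
        (((CategoryTheory.Tor (ModuleCat.{u} R) 1).obj (ModuleCat.of R M)).obj
          (ModuleCat.of R (PiTensorProduct R N))) →
      ∀ i, Module.Free R (N i)) := by
  choose φ hφ using fun i ↦ exists_surjective_of_minGens (R := R) (N i)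
  have hinj i := lTensor_injective_of_isUnmixed hunmixed hmult (hdim i) (hCM i) (hφ i)
  have hker i := ker_le_annihilator_smul (hinj i)
  -- Since `t ≥ 1` there is some `N i`, and `M ⊗ N i` is a nonempty direct sum of copies of `M`, so
  -- Cohen-Macaulayness descends to `M`.
  have hMCM : IsCohenMacaulay R M := by
    let e := (LinearEquiv.ofBijective _ ⟨hinj ⟨0, ht⟩,
      LinearMap.lTensor_surjective M (hφ _)⟩).symm ≪≫ₗ
      TensorProduct.piScalarRight R R M (Fin (minGens R (N ⟨0, ht⟩)))
    exact (isCohenMacaulay_iff_of_equiv_pi e (minGens_ne_zero (N ⟨0, ht⟩))).mp (hCM _)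
  have hulrich {P Q : Type u} [AddCommGroup P] [Module R P] [AddCommGroup Q] [Module R Q]
      [Module.Free R P] [Module.Finite R P] (ψ : P →ₗ[R] Q) (hψ : Function.Surjective ψ)
      (hψk : LinearMap.ker ψ ≤ Module.annihilator R M • ⊤) : IsUlrich R (M ⊗[R] Q) := by
    obtain ⟨n, ⟨e⟩⟩ := exists_tensorProduct_equiv_pi (R := R) M P
    exact isUlrich_of_equiv_pi ((LinearEquiv.ofBijective _ ⟨lTensor_injective_of_ker_le hψ hψk,
      LinearMap.lTensor_surjective M hψ⟩).symm ≪≫ₗ e) hMCM hmult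
  have hsurj := piTensorProduct_map_surjective hφ
  have hkerPi := ker_piTensorProduct_map_le hφ hker
  have hinjPi := lTensor_injective_of_ker_le hsurj hkerPi
  refine ⟨⟨LinearEquiv.ofBijective _ ⟨hinjPi, LinearMap.lTensor_surjective M hsurj⟩⟩,
    ⟨hulrich _ hsurj hkerPi, fun i r ↦ hulrich (exteriorPower.map r (φ i))
      (exteriorPower.map_surjective (hφ i)) (ker_exteriorPower_map_le (hφ i) (hker i) r)⟩,
    fun hTor i ↦ ?_⟩
  have hK := lTensor_ker_subtype_injective_of_isZero_tor hTor hsurj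
  -- The composite `M ⊗ K → M ⊗ ⨂ F i → M ⊗ ⨂ N i` is zero, yet both maps are injective.
  have hsub : Subsingleton (M ⊗[R] LinearMap.ker (PiTensorProduct.map φ)) := by
    refine subsingleton_of_forall_eq 0 fun z ↦ hK (hinjPi ?_)
    rw [← LinearMap.lTensor_comp_apply, (LinearMap.exact_subtype_ker_map _).linearMap_comp_eq_zero]
    simp
  have hzero : LinearMap.ker (PiTensorProduct.map φ) = ⊥ :=
    (Submodule.subsingleton_iff_eq_bot).mp
      (subsingleton_of_subsingleton_tensorProduct (R := R) (M := M))
  exact Module.Free.of_equiv (LinearEquiv.ofBijective (φ i)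
    ⟨injective_of_injective_piTensorProduct_map (fun i ↦ minGens_ne_zero (N i))
      (LinearMap.ker_eq_bot.mp hzero) i, hφ i⟩)
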